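/- Notation. Configurations are $x=(x_1,\dots,x_n)\in\{1,\dots,d\}^n$ with $n\ge 1$. A matrix product state (MPS) $\theta$ with bond dimensions $r_1,\dots,r_{n-1}$ (and $r_0=r_n=1$) is a collection of real cores $G_k\in\mathbb R^{r_{k-1}\times d\times r_k}$, and $q_\theta(x)=\sum_{\alpha_1,\dots,\alpha_{n-1}}G_1(x_1,\alpha_1)G_2(\alpha_1,x_2,\alpha_2)\cdots G_n(\alpha_{n-1},x_n)$. A probability distribution $p^\star$ is representable by the Born machine $\theta$ if $p^\star(x)=|q_\theta(x)|^2/\sum_z|q_\theta(z)|^2$. Let $R_k$ be the rank of the $k$-th unfolding matrix $p^\star(x_1\cdots x_k;\,x_{k+1}\cdots x_n)$ (with $R_0=R_n=1$). TTNS-Sketch on a path. Let $S_k(\beta,x_1,\dots,x_k)$, $\beta\le m_k$, and $T_k(x_{k+1},\dots,x_n,\gamma)$, $\gamma\le l_k$, be real sketch functions with $m_0=l_n=1$, $S_0=T_n=1$. For a function $p$ on configurations put $W_k(\beta,\gamma)=\sum_x S_k(\beta,x_{\le k})\,p(x)\,T_k(x_{>k},\gamma)$ for $0\le k\le n$ and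 $Z_k(\beta,a;\gamma)=\sum_{x:\,x_k=a}S_{k-1}(\beta,x_{<k})\,p(x)\,T_k(x_{>k},\gamma)$ for $1\le k\le n$. For $1\le k<n$ take a singular value decomposition $Z_k\approx U\Sigma V^{T}$ truncated to the $R_k$ largest singular values and set $q_k=V\Sigma^{-1}$ (reciprocals of zero singular values being read as $0$); set $q_n=1$. Put $B_k=Z_kq_k$ for $1\le k\le n$, $A_0=1$, and $A_k=W_kq_k$ for $1\le k<n$. The output consists of cores $\hat G_k$ that solve $A_{k-1}\hat G_k=B_k$ in the least squares sense, for $k=1,\dots,n$. They form an MPS with bond dimensions $R_k$; write $\hat q$ for its value, $\hat W=\sum_z\hat q(z)$, and $\hat p_{\mathrm{TS}}=\hat q/\hat W$. The sketches preserve the ranks of $p^\star$ with constant $c>0$ if, for every $1\le k<n$, the $R_k$-th largest singular value of $W_k$ formed from $p=p^\star$ is at least $c$. Statement. 1. Let $p^\star$ be representable by a Born machine with bond dimensions $r_1,\dots,r_{n-1}$. Then $R_k\le r_k^2$ for all $k$, and there are sketch functions with values in $[-1,1]$ and with $m_k,l_k\le r_k^2$ for all $k$ that preserve the ranks of $p^\star$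 with some constant $c>0$. 2. For all $d,\ell\in\mathbb N$, $M\in\mathbb R$ and $c>0$ there is a constant $C=C(d,\ell,M,c)>0$ such that the following holds for all $n\ge1$, all distributions $p^\star$ on $\{1,\dots,d\}^n$ representable by a Born machine with bond dimensions $r_k$, all sketch functions bounded in absolute value by $M$, with $m_k,l_k\le\ell$, that preserve the ranks of $p^\star$ with constant $c$, and all $0<\epsilon\le1$, $0<\delta<1$. Run TTNS-Sketch with target ranks $R_k$ on the empirical distribution of $B$ independent samples of $p^\star$, where $$B\ \ge\ C\,\frac{n^2+\epsilon n}{\epsilon^2}\,\log\frac{2n}{\delta}.$$ Then an output exists for every sample, and with probability at least $1-\delta$ every output (whatever choices are made in the singular value decompositions and least squares problems) has bond dimensions at most $r_k^2$, satisfies $\hat W\ne0$, $\|p^\star-\hat p_{\mathrm{TS}}\|_\infty<\epsilon$ and also $\|p^\star-\hat q\|_\infty<\epsilon$. -/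

import Mathlib

open scoped Matrix
open MeasureTheory

noncomputable section

/-- Configurations of `n` variables, each with `d` possible values. -/
abbrev Config (n d : ℕ) : Type := Fin n → Fin d

/-- A matrix product state with open boundary: bond dimensions `bond 0 = 1, …, bond n = 1` and, for
every site `k`, a core `G_k(α, x_k, α')`, where `α` and `α'` are the indices of the bonds to the left
and to the right of the site. -/
structure MPS (n d : ℕ) where
  bond : Fin (n + 1) → ℕ
  bond_zero : bond 0 = 1
  bond_last : bond (Fin.last n) = 1
  core : (k : Fin n) → Fin d → Matrix (Fin (bond k.castSucc)) (Fin (bond k.succ)) ℝ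

namespace MPS

variable {n d : ℕ} (θ : MPS n d)

/-- `q_θ(x) = ∑_α ∏_k G_k(α_{k-1}, x_k, α_k)`. -/
def eval (x : Config n d) : ℝ :=
  ∑ α : (k : Fin (n + 1)) → Fin (θ.bond k), ∏ k : Fin n, θ.core k (x k) (α k.castSucc) (α k.succ)

/-- The Born machine density `|q_θ|² / Z_θ` with `Z_θ = ∑_z |q_θ(z)|²`. -/
def bornDensity (x : Config n d) : ℝ := |θ.eval x| ^ 2 / ∑ z, |θ.eval z| ^ 2

/-- The normalization constant `W_θ = ∑_z q_θ(z)` of the direct MPS ansatz. -/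
def weight : ℝ := ∑ z, θ.eval z

/-- The direct MPS ansatz `q_θ / W_θ`. -/
def directDensity (x : Config n d) : ℝ := θ.eval x / θ.weight

end MPS

/-- The unfolding of a tensor at bond `k`: rows are indexed by the variables to the left of the bond,
columns by the variables to the right of it. -/
def unfolding {n d : ℕ} (p : Config n d → ℝ) (k : Fin (n + 1)) :
    Matrix ({i : Fin n // i.castSucc < k} → Fin d) ({i : Fin n // ¬ i.castSucc < k} → Fin d) ℝ :=
  Matrix.of fun y z => p fun i => if h : i.castSucc < k then y ⟨i, h⟩ else z ⟨i, h⟩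

/-- The rank of the unfolding at bond `k`. -/
def unfoldingRank {n d : ℕ} (p : Config n d → ℝ) (k : Fin (n + 1)) : ℕ := (unfolding p k).rank

/-- Sketch functions for the path `1 - 2 - ⋯ - n`. At every bond `k` there are `m k` left sketch
functions of the variables to the left of the bond and `l k` right sketch functions of the variables
to the right of it. At the two ends the (empty) sketch is the constant `1`. -/
structure Sketch (n d : ℕ) where
  m : Fin (n + 1) → ℕ
  l : Fin (n + 1) → ℕ
  S : (k : Fin (n + 1)) → Config n d → Fin (m k) → ℝ
  T : (k : Fin (n + 1)) → Config n d → Fin (l k) → ℝ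
  S_dependsOn : ∀ k, DependsOn (S k) {i : Fin n | i.castSucc < k}
  T_dependsOn : ∀ k, DependsOn (T k) {i : Fin n | ¬ i.castSucc < k}
  m_zero : m 0 = 1
  l_last : l (Fin.last n) = 1
  S_zero : ∀ x β, S 0 x β = 1
  T_last : ∀ x γ, T (Fin.last n) x γ = 1

namespace Sketch

variable {n d : ℕ} (sk : Sketch n d) (p : Config n d → ℝ)

/-- The sketched tensor at bond `k`: `∑_x S_k(β, x_{≤ k}) p(x) T_k(x_{> k}, γ)`. -/
def bondMoment (k : Fin (n + 1)) : Matrix (Fin (sk.m k)) (Fin (sk.l k)) ℝ :=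
  Matrix.of fun β γ => ∑ x, sk.S k x β * p x * sk.T k x γ

/-- The sketched tensor at site `k`, in which all variables but `x_k` are sketched; its rows are
indexed by pairs `(β, a)`, where `β` is a left sketch index and `a` is the value of `x_k`. -/
def siteMoment (k : Fin n) : Matrix (Fin (sk.m k.castSucc) × Fin d) (Fin (sk.l k.succ)) ℝ :=
  Matrix.of fun βa γ =>
    ∑ x, sk.S k.castSucc x βa.1 * (if x k = βa.2 then p x else 0) * sk.T k.succ x γ

/-- All sketch functions are bounded by `M` and there are at most `ℓ` of them on either side of every
bond. -/
def BoundedBy (ℓ : ℕ) (M : ℝ) : Prop :=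
  (∀ k, sk.m k ≤ ℓ ∧ sk.l k ≤ ℓ) ∧ (∀ k x β, |sk.S k x β| ≤ M) ∧ (∀ k x γ, |sk.T k x γ| ≤ M)

end Sketch

/-- The `i`-th largest singular value of a matrix (counted from `0`). -/
def singVal {ι κ : Type} [Fintype ι] [Fintype κ] [DecidableEq κ] (Z : Matrix ι κ ℝ) (i : ℕ) : ℝ :=
  (Matrix.toEuclideanLin Z).singularValues i

/-- The sketches preserve the ranks of `p` with constant `c`: at every interior bond, where the
unfolding of `p` has rank `R ≥ 1`, the `R`-th largest singular value of the sketched unfolding is at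
least `c`. -/
def Sketch.PreservesRank {n d : ℕ} (sk : Sketch n d) (p : Config n d → ℝ) (c : ℝ) : Prop :=
  ∀ k : Fin (n + 1), k ≠ 0 → k ≠ Fin.last n → c ≤ singVal (sk.bondMoment p k) (unfoldingRank p k - 1)

/-- `q = V Σ⁻¹`, where `Z ≈ U Σ Vᵀ` is a singular value decomposition of `Z` truncated to the `R`
largest singular values; hence `Z q = U`. -/
def IsTruncatedGauge {ι : Type} [Fintype ι] {l R : ℕ} (Z : Matrix ι (Fin l) ℝ)
    (q : Matrix (Fin l) (Fin R) ℝ) : Prop :=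
  ∃ V : Matrix (Fin l) (Fin R) ℝ, Vᵀ * V = 1 ∧
    (Zᵀ * Z) * V = V * Matrix.diagonal (fun i : Fin R => singVal Z i ^ 2) ∧
    q = V * Matrix.diagonal (fun i : Fin R => (singVal Z i)⁻¹)

/-- `X` is a least squares solution of `A X = B` (normal equations). -/
def IsLeastSquares {m R s : ℕ} (A : Matrix (Fin m) (Fin R) ℝ) (X : Matrix (Fin R) (Fin s) ℝ)
    (B : Matrix (Fin m) (Fin s) ℝ) : Prop :=
  Aᵀ * A * X = Aᵀ * B

/-- `ψ` is an output of the TTNS-Sketch algorithm on a path, for the input tensor `p` (in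
applications, an empirical distribution), the sketches `sk` and the target ranks `R`.

* Sketching: form the site tensors `Z_k` and the bond matrices `W_k`.
* Trimming: for each site but the last one, take a truncated singular value decomposition of `Z_k`,
  with gauge `q` at the bond on its right, so that `B_k = Z_k q` holds the left singular vectors;
  at the last site, `B_n = Z_n`.
* System forming: `A_k = W_k q_k`, and `A = 1` at the left end.
* Solving: the core at every site solves the linear system `A G = B` in the least squares sense. -/
def IsTTNSSketchOutput {n d : ℕ} (sk : Sketch n d) (p : Config n d → ℝ) (R : Fin (n + 1) → ℕ)
    (ψ : MPS n d) : Prop :=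
  (∀ k, ψ.bond k = R k) ∧
  ∃ (q : (k : Fin (n + 1)) → Matrix (Fin (sk.l k)) (Fin (ψ.bond k)) ℝ)
    (A : (k : Fin (n + 1)) → Matrix (Fin (sk.m k)) (Fin (ψ.bond k)) ℝ),
    (∀ k : Fin n, k.succ ≠ Fin.last n → IsTruncatedGauge (sk.siteMoment p k) (q k.succ)) ∧
    (∀ γ α, q (Fin.last n) γ α = 1) ∧
    (∀ β α, A 0 β α = 1) ∧
    (∀ k : Fin (n + 1), k ≠ 0 → A k = sk.bondMoment p k * q k) ∧
    ∀ (k : Fin n) (a : Fin d),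
      IsLeastSquares (A k.castSucc) (ψ.core k a)
        (Matrix.of fun β α => (sk.siteMoment p k * q k.succ) (β, a) α)

/-- The probability mass function of `p`, as a real-valued function. -/
def massFn {n d : ℕ} (p : PMF (Config n d)) : Config n d → ℝ := fun x => (p x).toReal

/-- The empirical distribution of `B` samples. -/
def empirical {n d B : ℕ} (ω : Fin B → Config n d) : Config n d → ℝ :=
  fun x => (Finset.card {b : Fin B | ω b = x} : ℝ) / B

/-- The law of `B` independent samples drawn from `p`. -/
def sampleLaw {n d : ℕ} (p : PMF (Config n d)) (B : ℕ) : Measure (Fin B → Config n d) :=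
  Measure.pi fun _ : Fin B => p.toMeasure

/-- `p` is the density of the Born machine `θ`. -/
def IsBornMachine {n d : ℕ} (p : PMF (Config n d)) (θ : MPS n d) : Prop :=
  ∀ x, massFn p x = θ.bornDensity x

end

/-! At every bond, `p` defines a bilinear form `pairing` between functions of the left sites and
functions of the right sites, whose rank R is that of the unfolding. Rank preservation provides R
combinations of the right sketches that are nondegenerate, with constant c, against the left
sketches. By a dimension count, every right function then acts under this form like a sketched one,
whose coefficients are at most its sketched values divided by c (`exists_sketch_eq_pairing`).
Consequently the site moment and the bond moment control each other with constants free of n, and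
the R-th singular value of the site moment stays bounded below, even after a small perturbation
(`gauge_bounds`).

Singular vectors need not be stable under perturbation, so the empirical gauge is never compared
with an exact one. Instead the exact `p` is sketched in the empirical gauge: the gauged right
sketches and a dual family of left functions factor `p` at each bond (`IsBondFrame`), and the exact
cores in these frames solve the unperturbed versions of the very systems that the algorithm solves.
Stability of least squares then bounds the error of each core (`cores_close`).

The cores are exchanged one at a time. Duality recovers the product of the cores left of a bond from
the hybrid tensor itself (`leftProd_eq_sum_hybrid`), so an exchange changes the tensor in ℓ¹ by at
most a constant times the core error times the current ℓ¹ norm. Errors therefore add up linearly in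
n instead of multiplying (`sum_abs_eval_sub_le`), and moments accurate to order ε/n suffice.
Hoeffding's inequality and a union bound over O(n) moment entries give the sample size.

For the rank statement, the square of an MPS value factors through pairs of bond indices. Indicator
sketches that read off a nonsingular R × R submatrix of each unfolding preserve the ranks. -/

open scoped Matrix
open MeasureTheory

noncomputable section

/-- The Euclidean norm of a tuple of real numbers. -/
def l2 {ι : Type*} [Fintype ι] (v : ι → ℝ) : ℝ := ‖WithLp.toLp 2 v‖

/-! ### Euclidean norm estimates -/

section EuclideanNorm

variable {ι κ : Type*} [Fintype ι] [Fintype κ]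

theorem l2_nonneg (v : ι → ℝ) : 0 ≤ l2 v := norm_nonneg _

theorem l2_add_le (v w : ι → ℝ) : l2 (v + w) ≤ l2 v + l2 w := by
  simpa [l2] using norm_add_le (WithLp.toLp 2 v) (WithLp.toLp 2 w)

theorem l2_sub_rev (v w : ι → ℝ) : l2 (v - w) = l2 (w - v) := by
  simpa [l2] using norm_sub_rev (WithLp.toLp 2 v) (WithLp.toLp 2 w)

theorem l2_le_add_sub (v w : ι → ℝ) : l2 v ≤ l2 w + l2 (v - w) := by
  simpa using l2_add_le w (v - w)

theorem l2_sq (v : ι → ℝ) : l2 v ^ 2 = v ⬝ᵥ v := by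
  rw [l2, EuclideanSpace.norm_sq_eq, dotProduct]
  exact Finset.sum_congr rfl fun i _ => by rw [Real.norm_eq_abs, sq_abs, sq]

theorem l2_sq_eq_sum (v : ι → ℝ) : l2 v ^ 2 = ∑ i, v i ^ 2 := by
  rw [l2_sq, dotProduct]; exact Finset.sum_congr rfl fun i _ => (sq _).symm

@[simp] theorem l2_zero : l2 (0 : ι → ℝ) = 0 := by simp [l2]

theorem l2_eq_zero {v : ι → ℝ} : l2 v = 0 ↔ v = 0 := by simp [l2]

theorem abs_le_l2 (v : ι → ℝ) (i : ι) : |v i| ≤ l2 v := by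
  simpa [l2] using PiLp.norm_apply_le (WithLp.toLp 2 v) i

theorem dotProduct_le_l2_mul (v w : ι → ℝ) : v ⬝ᵥ w ≤ l2 v * l2 w := by
  have h := real_inner_le_norm (WithLp.toLp 2 w) (WithLp.toLp 2 v)
  rw [EuclideanSpace.inner_eq_star_dotProduct] at h
  simpa [l2, mul_comm] using h

theorem l2_le_sum_abs (v : ι → ℝ) : l2 v ≤ ∑ i, |v i| := by
  refine le_of_sq_le_sq ?_ (Finset.sum_nonneg fun i _ => abs_nonneg _)
  rw [l2_sq_eq_sum]
  calc ∑ i, v i ^ 2 = ∑ i, |v i| ^ 2 := by simp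
    _ ≤ (∑ i, |v i|) ^ 2 := Finset.sum_sq_le_sq_sum_of_nonneg fun i _ => abs_nonneg _

theorem l2_le_card_mul {v : ι → ℝ} {b : ℝ} (h : ∀ i, |v i| ≤ b) : l2 v ≤ Fintype.card ι * b := by
  refine (l2_le_sum_abs v).trans ((Finset.sum_le_sum fun i _ => h i).trans ?_)
  simp

theorem abs_dotProduct_le {a v : ι → ℝ} {e : ℝ} (h : ∀ i, |a i| ≤ e) :
    |a ⬝ᵥ v| ≤ Fintype.card ι * e * l2 v := by
  calc |a ⬝ᵥ v| ≤ ∑ i, |a i * v i| := Finset.abs_sum_le_sum_abs _ _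
    _ ≤ ∑ _i : ι, e * l2 v := Finset.sum_le_sum fun i _ => by
        rw [abs_mul]
        exact mul_le_mul (h i) (abs_le_l2 v i) (abs_nonneg _) ((abs_nonneg _).trans (h i))
    _ = _ := by simp [mul_assoc]

theorem abs_dotProduct_le_of_le {a v : ι → ℝ} {e b : ℝ} (h : ∀ i, |a i| ≤ e) (hv : ∀ i, |v i| ≤ b) :
    |a ⬝ᵥ v| ≤ Fintype.card ι * (e * b) := by
  calc |a ⬝ᵥ v| ≤ ∑ i, |a i * v i| := Finset.abs_sum_le_sum_abs _ _
    _ ≤ ∑ _i : ι, e * b := Finset.sum_le_sum fun i _ => by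
        rw [abs_mul]
        exact mul_le_mul (h i) (hv i) (abs_nonneg _) ((abs_nonneg _).trans (h i))
    _ = _ := by simp

theorem l2_mulVec_le {E : Matrix ι κ ℝ} {e : ℝ} (h : ∀ i j, |E i j| ≤ e) (v : κ → ℝ) :
    l2 (E *ᵥ v) ≤ Fintype.card ι * (Fintype.card κ * e * l2 v) :=
  l2_le_card_mul fun i => abs_dotProduct_le (h i)

theorem l2_mulVec_single [DecidableEq κ] (E : Matrix ι κ ℝ) (i : ι) (j : κ) :
    |E i j| ≤ l2 (E *ᵥ Pi.single j 1) := by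
  simpa using abs_le_l2 (E *ᵥ Pi.single j 1) i

theorem l2_single [DecidableEq κ] (j : κ) : l2 (Pi.single j (1 : ℝ)) = 1 := by
  have h := l2_sq (Pi.single j (1 : ℝ))
  rw [single_one_dotProduct, Pi.single_eq_same] at h
  nlinarith [l2_nonneg (Pi.single j (1 : ℝ))]

theorem mulVec_dotProduct_mulVec (Z : Matrix ι κ ℝ) (u v : κ → ℝ) :
    (Z *ᵥ u) ⬝ᵥ (Z *ᵥ v) = u ⬝ᵥ ((Zᵀ * Z) *ᵥ v) := by
  rw [← Matrix.mulVec_mulVec, Matrix.dotProduct_mulVec u, Matrix.vecMul_transpose]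

theorem l2_mulVec_of_orthonormal [DecidableEq κ] {V : Matrix ι κ ℝ} (hV : Vᵀ * V = 1) (u : κ → ℝ) :
    l2 (V *ᵥ u) = l2 u := by
  refine (sq_eq_sq₀ (l2_nonneg _) (l2_nonneg _)).1 ?_
  rw [l2_sq, l2_sq, mulVec_dotProduct_mulVec, hV, Matrix.one_mulVec]

/-- The normal equations bound the solution by the right hand side. -/
theorem l2_le_of_normal_equation {A : Matrix ι κ ℝ} {τ : ℝ}
    (hA : ∀ u, τ * l2 u ≤ l2 (A *ᵥ u)) {u : κ → ℝ} {r : ι → ℝ}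
    (h : (Aᵀ * A) *ᵥ u = Aᵀ *ᵥ r) : τ * l2 u ≤ l2 r := by
  refine (hA u).trans ?_
  have h1 : l2 (A *ᵥ u) ^ 2 ≤ l2 (A *ᵥ u) * l2 r := by
    rw [l2_sq, mulVec_dotProduct_mulVec, h, Matrix.dotProduct_mulVec, Matrix.vecMul_transpose]
    exact dotProduct_le_l2_mul _ _
  rcases (l2_nonneg (A *ᵥ u)).eq_or_lt with h0 | h0
  · rw [← h0]; exact l2_nonneg _
  · rw [sq] at h1; exact le_of_mul_le_mul_left h1 h0

end EuclideanNorm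

/-! ### Singular values and right singular vectors -/

section SingularValues

variable {ι : Type} [Fintype ι] {l R : ℕ} (Z : Matrix ι (Fin l) ℝ)

theorem singVal_nonneg (i : ℕ) : 0 ≤ singVal Z i := LinearMap.singularValues_nonneg _ _

theorem singVal_antitone : Antitone (singVal Z) := LinearMap.singularValues_antitone _

theorem lt_of_singVal_pos {i : ℕ} (h : 0 < singVal Z i) : i < l := by
  by_contra hi
  refine h.ne' (LinearMap.singularValues_of_finrank_le _ ?_)
  simpa using hi

theorem singVal_pos_of_lt_rank {i : ℕ} (h : i < Z.rank) : 0 < singVal Z i := by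
  refine (LinearMap.singularValues_pos_iff_lt_finrank_range _).2 ?_
  rwa [Matrix.rank_eq_finrank_range_toLin Z (EuclideanSpace.basisFun ι ℝ).toBasis
    (EuclideanSpace.basisFun (Fin l) ℝ).toBasis, ← Matrix.toEuclideanLin_eq_toLin_orthonormal] at h

/-- Right singular vectors of a matrix, as an orthogonal matrix. -/
theorem exists_rightSingularVectors : ∃ V : Matrix (Fin l) (Fin l) ℝ, Vᵀ * V = 1 ∧
    (Zᵀ * Z) * V = V * Matrix.diagonal (fun i : Fin l => singVal Z i ^ 2) := by
  set T := Matrix.toEuclideanLin Z with hT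
  have hn : Module.finrank ℝ (EuclideanSpace ℝ (Fin l)) = l := finrank_euclideanSpace_fin
  set b := T.isSymmetric_adjoint_comp_self.eigenvectorBasis hn with hb
  refine ⟨Matrix.of fun i j => b j i, ?_, ?_⟩
  · ext i j
    have := orthonormal_iff_ite.1 b.orthonormal i j
    rw [EuclideanSpace.inner_eq_star_dotProduct] at this
    rw [Matrix.mul_apply, Matrix.one_apply, ← this, dotProduct]
    exact Finset.sum_congr rfl fun k _ => by simp [mul_comm]
  · classical
    ext i j
    have h := T.isSymmetric_adjoint_comp_self.apply_eigenvectorBasis hn j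
    have h3 : LinearMap.adjoint T (T (b j)) =
        Matrix.toEuclideanLin Zᴴ (Matrix.toEuclideanLin Z (b j)) := by
      rw [Matrix.toEuclideanLin_conjTranspose_eq_adjoint]
    rw [← T.sq_singularValues_fin hn, LinearMap.comp_apply, ← hb, h3, Matrix.toLpLin_apply,
      Matrix.toLpLin_apply] at h
    have h' := congrArg (fun v : EuclideanSpace ℝ (Fin l) => v i) h
    simp only [Matrix.mulVec_mulVec, Matrix.conjTranspose_eq_transpose_of_trivial] at h'
    rw [Matrix.mul_diagonal]
    refine Eq.trans ?_ (h'.trans ?_)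
    · rfl
    · simp [mul_comm, singVal, hb, hT]

theorem exists_rightSingularVectors_of_le (hR : R ≤ l) :
    ∃ V : Matrix (Fin l) (Fin R) ℝ, Vᵀ * V = 1 ∧
      (Zᵀ * Z) * V = V * Matrix.diagonal (fun i : Fin R => singVal Z i ^ 2) := by
  obtain ⟨V, h1, h2⟩ := exists_rightSingularVectors Z
  refine ⟨V.submatrix id (Fin.castLE hR), ?_, ?_⟩
  · ext i j
    have := congrFun (congrFun h1 (Fin.castLE hR i)) (Fin.castLE hR j)
    simpa [Matrix.mul_apply, Matrix.one_apply] using this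
  · ext i j
    have := congrFun (congrFun h2 i) (Fin.castLE hR j)
    rw [Matrix.mul_diagonal] at this ⊢
    exact this

theorem exists_isTruncatedGauge (hR : R ≤ l) :
    ∃ q : Matrix (Fin l) (Fin R) ℝ, IsTruncatedGauge Z q := by
  obtain ⟨V, h1, h2⟩ := exists_rightSingularVectors_of_le Z hR
  exact ⟨_, V, h1, h2, rfl⟩

variable {Z}

theorem l2_sq_mulVec_rightSingularVectors {V : Matrix (Fin l) (Fin R) ℝ} (h1 : Vᵀ * V = 1)
    (h2 : (Zᵀ * Z) * V = V * Matrix.diagonal (fun i : Fin R => singVal Z i ^ 2)) (u : Fin R → ℝ) :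
    l2 (Z *ᵥ (V *ᵥ u)) ^ 2 = ∑ i : Fin R, singVal Z i ^ 2 * u i ^ 2 := by
  rw [l2_sq, mulVec_dotProduct_mulVec, Matrix.mulVec_mulVec, h2, ← Matrix.mulVec_mulVec,
    Matrix.dotProduct_mulVec, ← Matrix.mulVec_transpose, Matrix.mulVec_mulVec, h1,
    Matrix.one_mulVec, dotProduct]
  exact Finset.sum_congr rfl fun i _ => by rw [Matrix.mulVec_diagonal]; ring

theorem le_l2_mulVec_rightSingularVectors {V : Matrix (Fin l) (Fin R) ℝ} (h1 : Vᵀ * V = 1)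
    (h2 : (Zᵀ * Z) * V = V * Matrix.diagonal (fun i : Fin R => singVal Z i ^ 2)) {s : ℝ}
    (hs : 0 ≤ s) (hsv : s ≤ singVal Z (R - 1)) (u : Fin R → ℝ) :
    s * l2 u ≤ l2 (Z *ᵥ (V *ᵥ u)) := by
  refine le_of_sq_le_sq ?_ (l2_nonneg _)
  rw [l2_sq_mulVec_rightSingularVectors h1 h2, mul_pow, l2_sq_eq_sum, Finset.mul_sum]
  refine Finset.sum_le_sum fun i _ => mul_le_mul_of_nonneg_right ?_ (sq_nonneg _)
  exact pow_le_pow_left₀ hs (hsv.trans (singVal_antitone Z (show (_ : ℕ) ≤ _ by omega))) 2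

/-- The span of the top R right singular vectors works; R ≤ l because singular values with index at
least l vanish. -/
theorem exists_subspace_of_le_singVal {c : ℝ} (hc : 0 < c) (h : c ≤ singVal Z (R - 1)) :
    R ≤ l ∧ ∃ Y : Matrix (Fin l) (Fin R) ℝ, (∀ u, l2 (Y *ᵥ u) = l2 u) ∧
      ∀ u, c * l2 u ≤ l2 (Z *ᵥ (Y *ᵥ u)) := by
  have hR : R ≤ l := by have := lt_of_singVal_pos Z (hc.trans_le h); omega
  obtain ⟨V, h1, h2⟩ := exists_rightSingularVectors_of_le Z hR
  exact ⟨hR, V, l2_mulVec_of_orthonormal h1, le_l2_mulVec_rightSingularVectors h1 h2 hc.le h⟩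

/-- The lower bound in the Courant-Fischer theorem. -/
theorem le_singVal_of_subspace (hR : 1 ≤ R) {t : ℝ} {Y : Matrix (Fin l) (Fin R) ℝ}
    (hY : ∀ u, l2 (Y *ᵥ u) = l2 u) (h : ∀ u, t * l2 u ≤ l2 (Z *ᵥ (Y *ᵥ u))) :
    t ≤ singVal Z (R - 1) := by
  obtain ⟨V, h1, h2⟩ := exists_rightSingularVectors Z
  have h1' : V * Vᵀ = 1 := mul_eq_one_comm.1 h1
  -- `φ` reads the first R - 1 coordinates of `Y *ᵥ u` in the singular basis. It has a nonzero
  -- kernel vector, on which `Z` stretches by at most the singular value of index R - 1.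
  let φ : (Fin R → ℝ) →ₗ[ℝ] (Fin (R - 1) → ℝ) :=
    { toFun := fun u i => if hi : (i : ℕ) < l then ((Vᵀ * Y) *ᵥ u) ⟨i, hi⟩ else 0
      map_add' := fun u v => by ext i; by_cases hi : (i : ℕ) < l <;> simp [hi, Matrix.mulVec_add]
      map_smul' := fun a u => by ext i; by_cases hi : (i : ℕ) < l <;> simp [hi, Matrix.mulVec_smul] }
  obtain ⟨u, hu, hu0⟩ := Submodule.exists_mem_ne_zero_of_ne_bot
    (LinearMap.ker_ne_bot_of_finrank_lt (f := φ) (by simp; omega))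
  have hpos : 0 < l2 u := (l2_nonneg u).lt_of_ne fun h => hu0 (l2_eq_zero.1 h.symm)
  refine le_of_mul_le_mul_right ((h u).trans ?_) hpos
  refine le_of_sq_le_sq ?_ (mul_nonneg (singVal_nonneg _ _) hpos.le)
  have hy : Y *ᵥ u = V *ᵥ ((Vᵀ * Y) *ᵥ u) := by
    rw [Matrix.mulVec_mulVec, ← Matrix.mul_assoc, h1', Matrix.one_mul]
  have hl : l2 ((Vᵀ * Y) *ᵥ u) = l2 u := by
    rw [← l2_mulVec_of_orthonormal h1, ← hy, hY]
  rw [hy, l2_sq_mulVec_rightSingularVectors h1 h2, mul_pow, ← hl, l2_sq_eq_sum, Finset.mul_sum]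
  refine Finset.sum_le_sum fun i _ => ?_
  by_cases hi : (i : ℕ) < R - 1
  · have := congrFun (LinearMap.mem_ker.1 hu) ⟨i, hi⟩
    have h0 : ((Vᵀ * Y) *ᵥ u) i = 0 := by simpa [φ] using this
    simp [h0]
  · exact mul_le_mul_of_nonneg_right
      (pow_le_pow_left₀ (singVal_nonneg _ _) (singVal_antitone Z (show (_ : ℕ) ≤ _ by omega)) 2) (sq_nonneg _)

end SingularValues

/-- `U * X` is injective on an R-dimensional space, so its range already has the dimension of the
range of `U` and fills it. -/
theorem Matrix.exists_mulVec_eq_of_rank_eq {ι κ : Type*} [Fintype ι] [Fintype κ] {R : ℕ}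
    (U : Matrix ι κ ℝ) (X : Matrix κ (Fin R) ℝ) (hR : U.rank = R)
    (hX : ∀ u, U *ᵥ (X *ᵥ u) = 0 → u = 0) (g : κ → ℝ) : ∃ u, U *ᵥ g = U *ᵥ (X *ᵥ u) := by
  have hle : LinearMap.range (U * X).mulVecLin ≤ LinearMap.range U.mulVecLin := by
    rintro _ ⟨u, rfl⟩
    exact ⟨X *ᵥ u, by simp [Matrix.mulVec_mulVec]⟩
  have hinj : Function.Injective (U * X).mulVecLin := by
    refine (injective_iff_map_eq_zero _).2 fun u hu => hX u ?_
    rwa [Matrix.mulVecLin_apply, ← Matrix.mulVec_mulVec] at hu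
  have heq := Submodule.eq_of_le_of_finrank_eq hle (by
    rw [LinearMap.finrank_range_of_inj hinj]
    simpa [Matrix.rank] using hR.symm)
  have hg : U *ᵥ g ∈ LinearMap.range (U * X).mulVecLin := heq ▸ ⟨g, rfl⟩
  obtain ⟨u, hu⟩ := hg
  exact ⟨u, by rw [← hu, Matrix.mulVecLin_apply, Matrix.mulVec_mulVec]⟩

/-! ### The bilinear form of a density across a bond -/

section Pairing

variable {n d : ℕ}

/-- The sites to the left of the bond `k`. -/
abbrev leftSites (k : Fin (n + 1)) : Set (Fin n) := {i : Fin n | i.castSucc < k}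

/-- The sites to the right of the bond `k`. -/
abbrev rightSites (k : Fin (n + 1)) : Set (Fin n) := {i : Fin n | ¬ i.castSucc < k}

/-- The bilinear form `∑_x f(x) p(x) g(x)`. -/
def pairing (p f g : Config n d → ℝ) : ℝ := ∑ x, f x * p x * g x

theorem pairing_sum_right {ι : Type*} (s : Finset ι) (p f : Config n d → ℝ)
    (g : ι → Config n d → ℝ) :
    pairing p f (fun x => ∑ i ∈ s, g i x) = ∑ i ∈ s, pairing p f (g i) := by
  simp only [pairing, Finset.mul_sum]
  exact Finset.sum_comm

theorem pairing_sum_left {ι : Type*} (s : Finset ι) (p g : Config n d → ℝ)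
    (f : ι → Config n d → ℝ) :
    pairing p (fun x => ∑ i ∈ s, f i x) g = ∑ i ∈ s, pairing p (f i) g := by
  simp only [pairing, Finset.sum_mul]
  exact Finset.sum_comm

theorem pairing_const_mul_left (p f g : Config n d → ℝ) (a : ℝ) :
    pairing p (fun x => a * f x) g = a * pairing p f g := by
  simp only [pairing, Finset.mul_sum]
  exact Finset.sum_congr rfl fun x _ => by ring

theorem pairing_mul_const_right (p f g : Config n d → ℝ) (a : ℝ) :
    pairing p f (fun x => g x * a) = pairing p f g * a := by
  simp only [pairing, Finset.sum_mul]
  exact Finset.sum_congr rfl fun x _ => by ring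

theorem pairing_dotProduct {ι : Type*} [Fintype ι] (p f : Config n d → ℝ)
    (D : Config n d → ι → ℝ) (u : ι → ℝ) :
    pairing p f (fun x => D x ⬝ᵥ u) = (fun i => pairing p f (D · i)) ⬝ᵥ u := by
  simp only [dotProduct, pairing_sum_right, pairing_mul_const_right]

theorem dotProduct_pairing {ι : Type*} [Fintype ι] (p g : Config n d → ℝ)
    (S : Config n d → ι → ℝ) (v : ι → ℝ) :
    pairing p (fun x => v ⬝ᵥ S x) g = v ⬝ᵥ (fun i => pairing p (S · i) g) := by
  simp only [dotProduct, pairing_sum_left, pairing_const_mul_left]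

theorem abs_pairing_le {p f g : Config n d → ℝ} (hp : ∀ x, 0 ≤ p x) (hp1 : ∑ x, p x = 1)
    {a b : ℝ} (hf : ∀ x, |f x| ≤ a) (hg : ∀ x, |g x| ≤ b) (ha : 0 ≤ a) :
    |pairing p f g| ≤ a * b := by
  calc |pairing p f g| ≤ ∑ x, |f x * p x * g x| := Finset.abs_sum_le_sum_abs _ _
    _ ≤ ∑ x, (a * b) * p x := Finset.sum_le_sum fun x _ => by
        rw [abs_mul, abs_mul, abs_of_nonneg (hp x)]
        calc |f x| * p x * |g x| = (|f x| * |g x|) * p x := by ring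
          _ ≤ (a * b) * p x := mul_le_mul_of_nonneg_right
            (mul_le_mul (hf x) (hg x) (abs_nonneg _) ha) (hp x)
    _ = a * b := by rw [← Finset.mul_sum, hp1, mul_one]

theorem dependsOn_dotProduct {ι : Type*} [Fintype ι] {D : Config n d → ι → ℝ} {s : Set (Fin n)}
    (hD : DependsOn D s) (u : ι → ℝ) : DependsOn (fun x => D x ⬝ᵥ u) s :=
  fun x y h => by simp only [hD h]

/-- A configuration is a pair of a configuration of the left sites and one of the right sites. -/
def splitAt (k : Fin (n + 1)) : Config n d ≃
    ({i : Fin n // i.castSucc < k} → Fin d) × ({i : Fin n // ¬ i.castSucc < k} → Fin d) :=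
  Equiv.piEquivPiSubtypeProd (fun i : Fin n => i.castSucc < k) (fun _ => Fin d)

theorem splitAt_symm_left {k : Fin (n + 1)} (y : {i : Fin n // i.castSucc < k} → Fin d)
    (z : {i : Fin n // ¬ i.castSucc < k} → Fin d) {i : Fin n} (h : i.castSucc < k) :
    (splitAt k).symm (y, z) i = y ⟨i, h⟩ := dif_pos h

theorem splitAt_symm_right {k : Fin (n + 1)} (y : {i : Fin n // i.castSucc < k} → Fin d)
    (z : {i : Fin n // ¬ i.castSucc < k} → Fin d) {i : Fin n} (h : ¬ i.castSucc < k) :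
    (splitAt k).symm (y, z) i = z ⟨i, h⟩ := dif_neg h

/-- Each function ignores one side of the bond, so the reference configuration `x₀` may supply the
values there. -/
theorem pairing_eq_dotProduct_unfolding (p : Config n d → ℝ) (k : Fin (n + 1)) (x₀ : Config n d)
    {f g : Config n d → ℝ} (hf : DependsOn f (leftSites k)) (hg : DependsOn g (rightSites k)) :
    pairing p f g = (fun y => f ((splitAt k).symm (y, (splitAt k x₀).2))) ⬝ᵥ
      (unfolding p k *ᵥ fun z => g ((splitAt k).symm ((splitAt k x₀).1, z))) := by
  rw [pairing, ← (splitAt k).symm.sum_comp, Fintype.sum_prod_type]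
  refine Finset.sum_congr rfl fun y _ => ?_
  rw [Matrix.mulVec, dotProduct, Finset.mul_sum]
  refine Finset.sum_congr rfl fun z _ => ?_
  have h1 : f ((splitAt k).symm (y, z)) = f ((splitAt k).symm (y, (splitAt k x₀).2)) :=
    hf fun i hi => by rw [splitAt_symm_left _ _ hi, splitAt_symm_left _ _ hi]
  have h2 : g ((splitAt k).symm (y, z)) = g ((splitAt k).symm ((splitAt k x₀).1, z)) :=
    hg fun i hi => by rw [splitAt_symm_right _ _ hi, splitAt_symm_right _ _ hi]
  rw [h1, h2, mul_assoc]
  rfl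

/-- Completeness by counting: R right functions that are independent modulo the kernel of the form
span all right functions modulo that kernel, since the form has rank R. -/
theorem exists_dotProduct_eq_pairing {p : Config n d → ℝ} {k : Fin (n + 1)} (x₀ : Config n d)
    {R : ℕ} (hR : unfoldingRank p k = R) {D : Config n d → Fin R → ℝ}
    (hD : DependsOn D (rightSites k))
    (hinj : ∀ u, (∀ f, DependsOn f (leftSites k) → pairing p f (fun x => D x ⬝ᵥ u) = 0) → u = 0)
    {g : Config n d → ℝ} (hg : DependsOn g (rightSites k)) :
    ∃ u : Fin R → ℝ, ∀ f, DependsOn f (leftSites k) →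
      pairing p f g = pairing p f (fun x => D x ⬝ᵥ u) := by
  have key : ∀ f, DependsOn f (leftSites k) → ∀ u, pairing p f (fun x => D x ⬝ᵥ u) =
      (fun y => f ((splitAt k).symm (y, (splitAt k x₀).2))) ⬝ᵥ (unfolding p k *ᵥ
        ((Matrix.of fun z => D ((splitAt k).symm ((splitAt k x₀).1, z))) *ᵥ u)) := fun f hf u =>
    pairing_eq_dotProduct_unfolding p k x₀ hf (dependsOn_dotProduct hD u)
  obtain ⟨u, hu⟩ := Matrix.exists_mulVec_eq_of_rank_eq (unfolding p k)
    (Matrix.of fun z => D ((splitAt k).symm ((splitAt k x₀).1, z))) hR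
    (fun u hu => hinj u fun f hf => by rw [key f hf, hu, dotProduct_zero])
    (fun z => g ((splitAt k).symm ((splitAt k x₀).1, z)))
  refine ⟨u, fun f hf => ?_⟩
  rw [key f hf, ← hu, pairing_eq_dotProduct_unfolding p k x₀ hf hg]

end Pairing

/-! ### Sketched moments as pairings, and completeness of the sketches -/

section SketchMoments

variable {n d : ℕ} (sk : Sketch n d) (p : Config n d → ℝ)

theorem bondMoment_mulVec (k : Fin (n + 1)) (w : Fin (sk.l k) → ℝ) :
    sk.bondMoment p k *ᵥ w = fun β => pairing p (sk.S k · β) (fun x => sk.T k x ⬝ᵥ w) := by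
  ext β
  rw [pairing_dotProduct]
  rfl

/-- The indicator function of `x_k = a`. -/
def siteIndicator (k : Fin n) (a : Fin d) (x : Config n d) : ℝ := if x k = a then 1 else 0

theorem siteMoment_eq_pairing (k : Fin n) (β : Fin (sk.m k.castSucc)) (a : Fin d)
    (γ : Fin (sk.l k.succ)) : sk.siteMoment p k (β, a) γ =
      pairing p (sk.S k.castSucc · β) (fun x => siteIndicator k a x * sk.T k.succ x γ) := by
  simp only [Sketch.siteMoment, pairing, siteIndicator, Matrix.of_apply]
  refine Finset.sum_congr rfl fun x _ => ?_
  split_ifs <;> ring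

theorem siteMoment_mulVec (k : Fin n) (w : Fin (sk.l k.succ) → ℝ) :
    sk.siteMoment p k *ᵥ w = fun βa => pairing p (sk.S k.castSucc · βa.1)
      (fun x => siteIndicator k βa.2 x * (sk.T k.succ x ⬝ᵥ w)) := by
  ext ⟨β, a⟩
  have h : (fun x => siteIndicator k a x * (sk.T k.succ x ⬝ᵥ w)) =
      fun x => (fun γ => siteIndicator k a x * sk.T k.succ x γ) ⬝ᵥ w := by
    ext x
    simp only [dotProduct, Finset.mul_sum, mul_assoc]
  rw [h, pairing_dotProduct, Matrix.mulVec]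
  congr 1
  ext γ
  exact siteMoment_eq_pairing sk p k β a γ

variable {sk p}

/-- Where the sketches preserve the rank, sketched functions of the right sites are complete. -/
theorem exists_sketch_eq_pairing (x₀ : Config n d) {k : Fin (n + 1)} {c : ℝ} (hc : 0 < c)
    (hsv : c ≤ singVal (sk.bondMoment p k) (unfoldingRank p k - 1))
    {g : Config n d → ℝ} (hg : DependsOn g (rightSites k)) :
    ∃ w : Fin (sk.l k) → ℝ, (∀ f, DependsOn f (leftSites k) →
        pairing p f g = pairing p f (fun x => sk.T k x ⬝ᵥ w)) ∧
      c * l2 w ≤ l2 (fun β => pairing p (sk.S k · β) g) := by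
  -- Only the R combinations of right sketches given by `Y` are kept: their number matches the rank
  -- of the form, and the bond moment is bounded below on them.
  obtain ⟨-, Y, hY, hW⟩ := exists_subspace_of_le_singVal hc hsv
  have hS : ∀ β, DependsOn (sk.S k · β) (leftSites k) := fun β x y h => by
    simp only [sk.S_dependsOn k h]
  have hT : DependsOn (fun x => Yᵀ *ᵥ sk.T k x) (rightSites k) := fun x y h => by
    simp only [sk.T_dependsOn k h]
  have hTY : ∀ u, (fun x => (Yᵀ *ᵥ sk.T k x) ⬝ᵥ u) = fun x => sk.T k x ⬝ᵥ (Y *ᵥ u) := fun u => by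
    ext x
    rw [Matrix.dotProduct_mulVec, Matrix.mulVec_transpose]
  -- Independence is tested against the left sketches alone.
  obtain ⟨u, hu⟩ := exists_dotProduct_eq_pairing x₀ rfl hT (fun u hu => by
    have h0 : sk.bondMoment p k *ᵥ (Y *ᵥ u) = 0 := by
      rw [bondMoment_mulVec]
      ext β
      rw [← hTY]
      exact hu _ (hS β)
    have := hW u
    rw [h0, l2_zero] at this
    exact l2_eq_zero.1 (le_antisymm (nonpos_of_mul_nonpos_right this hc) (l2_nonneg _))) hg
  rw [hTY] at hu
  refine ⟨Y *ᵥ u, hu, ?_⟩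
  have h1 : (fun β => pairing p (sk.S k · β) g) = sk.bondMoment p k *ᵥ (Y *ᵥ u) := by
    rw [bondMoment_mulVec]
    ext β
    exact hu _ (hS β)
  rw [h1, hY]
  exact hW u

end SketchMoments

/-! ### Dual frames at a bond -/

section Frames

variable {n d : ℕ}

/-- Dual families `D` of functions of the right sites and `E` of functions of the left sites, bounded
by `K`, through which the bilinear form of `p` factors at the bond `k`. -/
structure IsBondFrame (p : Config n d → ℝ) (k : Fin (n + 1)) {R : ℕ}
    (D E : Config n d → Fin R → ℝ) (K : ℝ) : Prop where
  right_dependsOn : DependsOn D (rightSites k)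
  left_dependsOn : DependsOn E (leftSites k)
  right_le : ∀ x α, |D x α| ≤ K
  left_le : ∀ x α, |E x α| ≤ K
  pairing_eq : ∀ f g, DependsOn f (leftSites k) → DependsOn g (rightSites k) →
    pairing p f g = ∑ α, pairing p f (D · α) * pairing p (E · α) g
  dual : ∀ α α', pairing p (E · α) (D · α') = if α = α' then 1 else 0

theorem IsBondFrame.mono {p : Config n d → ℝ} {k : Fin (n + 1)} {R : ℕ}
    {D E : Config n d → Fin R → ℝ} {K K' : ℝ} (h : IsBondFrame p k D E K) (hK : K ≤ K') :
    IsBondFrame p k D E K' :=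
  { h with
    right_le := fun x α => (h.right_le x α).trans hK
    left_le := fun x α => (h.left_le x α).trans hK }

/-- A function of no sites is constant and `p` has total mass one, so the constant 1 is its own dual
frame. -/
theorem isBondFrame_zero {p : Config n d → ℝ} (hp1 : ∑ x, p x = 1) :
    IsBondFrame p 0 (fun _ (_ : Fin 1) => 1) (fun _ _ => 1) 1 where
  right_dependsOn := fun _ _ _ => rfl
  left_dependsOn := fun _ _ _ => rfl
  right_le := by simp
  left_le := by simp
  pairing_eq := fun f g hf _ => by
    rcases isEmpty_or_nonempty (Config n d) with h | ⟨⟨x₀⟩⟩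
    · simp [pairing]
    · have : ∀ x, f x = f x₀ := fun x => hf fun i hi => absurd hi (Fin.not_lt_zero _)
      simp [pairing, this, ← Finset.mul_sum, hp1, mul_assoc]
  dual := fun α α' => by simp [pairing, hp1, Subsingleton.elim α α']

theorem isBondFrame_last {p : Config n d → ℝ} (hp1 : ∑ x, p x = 1) :
    IsBondFrame p (Fin.last n) (fun _ (_ : Fin 1) => 1) (fun _ _ => 1) 1 where
  right_dependsOn := fun _ _ _ => rfl
  left_dependsOn := fun _ _ _ => rfl
  right_le := by simp
  left_le := by simp
  pairing_eq := fun f g _ hg => by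
    rcases isEmpty_or_nonempty (Config n d) with h | ⟨⟨x₀⟩⟩
    · simp [pairing]
    · have : ∀ x, g x = g x₀ := fun x => hg fun i hi => absurd (Fin.castSucc_lt_last i) hi
      simp [pairing, this, ← Finset.sum_mul, hp1]
  dual := fun α α' => by simp [pairing, hp1, Subsingleton.elim α α']

theorem unfoldingRank_pos {p : Config n d → ℝ} (hp : p ≠ 0) (k : Fin (n + 1)) :
    1 ≤ unfoldingRank p k := by
  by_contra h
  have h0 : unfoldingRank p k = 0 := by omega
  refine hp (funext fun x => ?_)
  have hr : LinearMap.range (unfolding p k).mulVecLin = ⊥ := Submodule.finrank_eq_zero.1 h0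
  have hz : (unfolding p k).mulVecLin = 0 := LinearMap.range_eq_bot.1 hr
  have h1 := congrFun (LinearMap.congr_fun hz (Pi.single (splitAt k x).2 1)) (splitAt k x).1
  simp only [Matrix.mulVecLin_apply, Matrix.mulVec_single_one, LinearMap.zero_apply,
    Pi.zero_apply, Matrix.col_apply] at h1
  have h2 : unfolding p k (splitAt k x).1 (splitAt k x).2 = p ((splitAt k).symm (splitAt k x)) := rfl
  rw [h2, Equiv.symm_apply_apply] at h1
  exact h1

end Frames

/-- `p` is a probability density and the sketches, bounded by `M ≥ 1` and at most `ℓ` in number at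
every bond, preserve its ranks with constant `c`. -/
structure Sketch.IsAdapted {n d : ℕ} (sk : Sketch n d) (p : Config n d → ℝ) (ℓ : ℕ) (M c : ℝ) :
    Prop where
  nonneg : ∀ x, 0 ≤ p x
  sum_eq_one : ∑ x, p x = 1
  bounded : sk.BoundedBy ℓ M
  one_le : 1 ≤ M
  pos : 0 < c
  preservesRank : sk.PreservesRank p c

namespace Sketch.IsAdapted

variable {n d ℓ : ℕ} {sk : Sketch n d} {p : Config n d → ℝ} {M c : ℝ}
  (h : sk.IsAdapted p ℓ M c)
include h

theorem nonempty : Nonempty (Config n d) := by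
  by_contra hne
  have := not_nonempty_iff.1 hne
  simpa using h.sum_eq_one

theorem ne_zero : p ≠ 0 := by
  rintro rfl
  simpa using h.sum_eq_one

theorem one_le_card : 1 ≤ ℓ := sk.m_zero ▸ (h.bounded.1 0).1

theorem one_le_dim (k : Fin n) : 1 ≤ d := by
  obtain ⟨x⟩ := h.nonempty
  exact Nat.one_le_iff_ne_zero.2 fun h0 => (h0 ▸ x k : Fin 0).elim0

theorem nonneg_bound : 0 ≤ M := zero_le_one.trans h.one_le

theorem card_left (k : Fin (n + 1)) : (sk.m k : ℝ) ≤ ℓ := by exact_mod_cast (h.bounded.1 k).1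

theorem card_right (k : Fin (n + 1)) : (sk.l k : ℝ) ≤ ℓ := by exact_mod_cast (h.bounded.1 k).2

end Sketch.IsAdapted

/-- The factor by which sketching a site can shrink vectors less than sketching its right bond. -/
def siteConst (d ℓ : ℕ) (M c : ℝ) : ℝ := ℓ * (d * (M * (ℓ * (M * M)) / c + M))

/-- A bound for the operator norm of sketched site tensors. -/
def opConst (d ℓ : ℕ) (M : ℝ) : ℝ := ℓ * d * (ℓ * (M * M + 1))

/-- A lower bound for the relevant singular values of sketched site tensors. -/
def gapConst (d ℓ : ℕ) (M c : ℝ) : ℝ := c / (2 * siteConst d ℓ M c)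

/-- A lower bound for the gauged bond matrices. -/
def bondConst (d ℓ : ℕ) (M c : ℝ) : ℝ :=
  c * (gapConst d ℓ M c / 2) / (opConst d ℓ M * opConst d ℓ M)

theorem dependsOn_siteIndicator {n d : ℕ} {k : Fin n} {a : Fin d} {s : Set (Fin n)} (hk : k ∈ s) :
    DependsOn (siteIndicator k a) s := fun x y h => by simp only [siteIndicator, h k hk]

theorem dependsOn_siteIndicator_mul {n d : ℕ} {k : Fin n} {a : Fin d} {g : Config n d → ℝ}
    (hg : DependsOn g (rightSites k.succ)) :
    DependsOn (fun x => siteIndicator k a x * g x) (rightSites k.castSucc) := fun x y h => by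
  have h1 : siteIndicator k a x = siteIndicator k a y :=
    dependsOn_siteIndicator (s := rightSites k.castSucc) (by simp) h
  have h2 : g x = g y := hg fun i hi => h i fun hi' =>
    hi (lt_trans hi' (Fin.castSucc_lt_succ))
  simp only [h1, h2]

theorem dependsOn_mul_siteIndicator {n d : ℕ} {k : Fin n} {a : Fin d} {f : Config n d → ℝ}
    (hf : DependsOn f (leftSites k.castSucc)) :
    DependsOn (fun x => f x * siteIndicator k a x) (leftSites k.succ) := fun x y h => by
  have h1 : siteIndicator k a x = siteIndicator k a y :=
    dependsOn_siteIndicator (s := leftSites k.succ) (by simp) h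
  have h2 : f x = f y := hf fun i hi => h i (lt_trans hi (Fin.castSucc_lt_succ))
  simp only [h1, h2]

theorem abs_siteIndicator_mul_le {n d : ℕ} (k : Fin n) (a : Fin d) (x : Config n d) (t : ℝ) :
    |siteIndicator k a x * t| ≤ |t| := by
  unfold siteIndicator
  split_ifs <;> simp

/-! ### Comparison of site and bond moments, and bounds for the gauge -/

namespace Sketch.IsAdapted

variable {n d ℓ : ℕ} {sk : Sketch n d} {p : Config n d → ℝ} {M c : ℝ}
  (h : sk.IsAdapted p ℓ M c)
include h

theorem siteConst_pos (k : Fin n) : 0 < siteConst d ℓ M c := by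
  have h1 : (1 : ℝ) ≤ ℓ := by exact_mod_cast h.one_le_card
  have h2 : (1 : ℝ) ≤ d := by exact_mod_cast h.one_le_dim k
  have h3 := h.one_le
  have h4 := h.pos
  unfold siteConst
  positivity

theorem opConst_pos (k : Fin n) : 0 < opConst d ℓ M := by
  have h1 : (1 : ℝ) ≤ ℓ := by exact_mod_cast h.one_le_card
  have h2 : (1 : ℝ) ≤ d := by exact_mod_cast h.one_le_dim k
  have h3 := h.one_le
  unfold opConst
  positivity

theorem gapConst_pos (k : Fin n) : 0 < gapConst d ℓ M c :=
  div_pos h.pos (mul_pos two_pos (h.siteConst_pos k))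

theorem bondConst_pos (k : Fin n) : 0 < bondConst d ℓ M c :=
  div_pos (mul_pos h.pos (half_pos (h.gapConst_pos k))) (mul_pos (h.opConst_pos k) (h.opConst_pos k))

theorem abs_pairing_sketch_le (k : Fin (n + 1)) {f : Config n d → ℝ} (hf : ∀ x, |f x| ≤ M)
    (w : Fin (sk.l k) → ℝ) :
    |pairing p f (fun x => sk.T k x ⬝ᵥ w)| ≤ M * (ℓ * (M * l2 w)) := by
  refine abs_pairing_le h.nonneg h.sum_eq_one hf (fun x => ?_) h.nonneg_bound
  refine (abs_dotProduct_le (h.bounded.2.2 k x)).trans ?_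
  rw [Fintype.card_fin, mul_assoc]
  exact mul_le_mul_of_nonneg_right (h.card_right k) (mul_nonneg h.nonneg_bound (l2_nonneg _))

/-- Completeness at the bond to the left of the site replaces `g` by a sketched function with
coefficients of size at most `t / c`. At the left end rank preservation is not assumed, but there
`f` is constant and the sketch is 1; this case accounts for the summand `M` in the constant. -/
theorem abs_pairing_site_le (k : Fin n)
    {f : Config n d → ℝ} (hf : DependsOn f (leftSites k.castSucc)) (hfM : ∀ x, |f x| ≤ M)
    {g : Config n d → ℝ} (hg : DependsOn g (rightSites k.castSucc)) {t : ℝ}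
    (ht : l2 (fun β => pairing p (sk.S k.castSucc · β) g) ≤ t) :
    |pairing p f g| ≤ (M * (ℓ * (M * M)) / c + M) * t := by
  obtain ⟨x₀⟩ := h.nonempty
  have hM := h.one_le
  have hc := h.pos
  have ht0 : 0 ≤ t := (l2_nonneg _).trans ht
  have hℓ : (0 : ℝ) ≤ ℓ := Nat.cast_nonneg _
  by_cases hk : k.castSucc = 0
  · have hconst : ∀ x, f x = f x₀ := fun x => hf fun i hi => by
      simp [leftSites, hk] at hi
    have hS : ∀ (j : Fin (n + 1)), j = 0 → ∃ β, ∀ x, sk.S j x β = 1 := by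
      rintro j rfl
      exact ⟨⟨0, by rw [sk.m_zero]; exact one_pos⟩, fun x => sk.S_zero x _⟩
    obtain ⟨β, hβ⟩ := hS _ hk
    have h1 : pairing p f g = f x₀ * pairing p (sk.S k.castSucc · β) g := by
      rw [← pairing_const_mul_left]
      simp only [hβ, mul_one]
      congr 1
      exact funext hconst
    rw [h1, abs_mul]
    have h2 : |pairing p (sk.S k.castSucc · β) g| ≤ t :=
      (abs_le_l2 (fun β => pairing p (sk.S k.castSucc · β) g) β).trans ht
    calc |f x₀| * |pairing p (sk.S k.castSucc · β) g| ≤ M * t :=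
          mul_le_mul (hfM _) h2 (abs_nonneg _) h.nonneg_bound
      _ ≤ _ := mul_le_mul_of_nonneg_right (by
          have : 0 ≤ M * (ℓ * (M * M)) / c := by positivity
          linarith) ht0
  · obtain ⟨w, hw, hcw⟩ := exists_sketch_eq_pairing x₀ hc
      (h.preservesRank _ hk (Fin.castSucc_lt_last k).ne) hg
    rw [hw f hf]
    refine (h.abs_pairing_sketch_le _ hfM w).trans ?_
    have hwt : l2 w ≤ t / c := (le_div_iff₀' hc).2 (hcw.trans ht)
    calc M * (ℓ * (M * l2 w)) ≤ M * (ℓ * (M * (t / c))) := by gcongr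
      -- A spare factor `M ≥ 1` is inserted.
      _ ≤ M * (ℓ * (M * M)) / c * t := by
          rw [show M * (ℓ * (M * (t / c))) = (M * (ℓ * M)) * (t / c) by ring,
            show M * (ℓ * (M * M)) / c * t = (M * (ℓ * M)) * M * (t / c) by ring]
          have : 0 ≤ (M * (ℓ * M)) * (t / c) := by positivity
          nlinarith
      _ ≤ _ := mul_le_mul_of_nonneg_right (by linarith) ht0

/-- Once the value of x_k is frozen, a left sketch at the right bond becomes a bounded function of
the sites before k, to which `abs_pairing_site_le` applies. This passes the singular value bound
from bond moments to site moments. -/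
theorem l2_bondMoment_le (k : Fin n) (v : Fin (sk.l k.succ) → ℝ) :
    l2 (sk.bondMoment p k.succ *ᵥ v) ≤ siteConst d ℓ M c * l2 (sk.siteMoment p k *ᵥ v) := by
  set t := l2 (sk.siteMoment p k *ᵥ v) with ht
  have ht0 : 0 ≤ t := l2_nonneg _
  have hM := h.one_le
  have hc := h.pos
  have hTv : DependsOn (fun x => sk.T k.succ x ⬝ᵥ v) (rightSites k.succ) :=
    dependsOn_dotProduct (sk.T_dependsOn _) v
  have hg : ∀ a, l2 (fun β => pairing p (sk.S k.castSucc · β)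
      (fun x => siteIndicator k a x * (sk.T k.succ x ⬝ᵥ v))) ≤ t := fun a => by
    refine le_of_sq_le_sq ?_ ht0
    rw [ht, siteMoment_mulVec, l2_sq_eq_sum, l2_sq_eq_sum, Fintype.sum_prod_type]
    exact Finset.sum_le_sum fun β _ => Finset.single_le_sum
      (f := fun a => (pairing p (sk.S k.castSucc · β)
      (fun x => siteIndicator k a x * (sk.T k.succ x ⬝ᵥ v))) ^ 2)
      (fun a _ => sq_nonneg _) (Finset.mem_univ a)
  have hβ : ∀ β, |(sk.bondMoment p k.succ *ᵥ v) β| ≤ d * ((M * (ℓ * (M * M)) / c + M) * t) := by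
    intro β
    -- The sum over `a` splits by the value of x_k; updating site k removes the dependence of the
    -- left sketch on it.
    have hsplit : (sk.bondMoment p k.succ *ᵥ v) β = ∑ a,
        pairing p (fun x => sk.S k.succ (Function.update x k a) β)
          (fun x => siteIndicator k a x * (sk.T k.succ x ⬝ᵥ v)) := by
      rw [bondMoment_mulVec]
      simp only [pairing]
      rw [Finset.sum_comm]
      refine Finset.sum_congr rfl fun x _ => ?_
      rw [Finset.sum_eq_single (x k)]
      · simp [siteIndicator]
      · intro a _ ha
        simp [siteIndicator, Ne.symm ha]
      · simp
    rw [hsplit]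
    refine (Finset.abs_sum_le_sum_abs _ _).trans ?_
    refine (Finset.sum_le_sum fun a _ => h.abs_pairing_site_le k ?_
      (fun x => h.bounded.2.1 _ _ _) (dependsOn_siteIndicator_mul hTv) (hg a)).trans ?_
    · intro x y hxy
      have : sk.S k.succ (Function.update x k a) = sk.S k.succ (Function.update y k a) :=
        sk.S_dependsOn _ fun i hi => by
          rcases eq_or_ne i k with rfl | hik
          · simp
          · have hi' : i.castSucc < k.castSucc := by
              simp only [Set.mem_ofPred_eq, Fin.castSucc_lt_succ_iff] at hi
              exact Fin.castSucc_lt_castSucc_iff.2 (lt_of_le_of_ne hi hik)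
            simp only [Function.update_of_ne hik]
            exact hxy i hi'
      simp only [this]
    · simp
  refine (l2_le_card_mul hβ).trans ?_
  rw [Fintype.card_fin, siteConst]
  have h0 : 0 ≤ M * (ℓ * (M * M)) / c + M := by positivity
  calc (sk.m k.succ : ℝ) * (d * ((M * (ℓ * (M * M)) / c + M) * t))
      ≤ ℓ * (d * ((M * (ℓ * (M * M)) / c + M) * t)) :=
        mul_le_mul_of_nonneg_right (h.card_left _) (by positivity)
    _ = _ := by ring

theorem l2_siteError_le (k : Fin n) {E : Matrix (Fin (sk.m k.castSucc) × Fin d) (Fin (sk.l k.succ)) ℝ}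
    {e : ℝ} (he0 : 0 ≤ e) (he : ∀ i j, |E i j| ≤ e) (v : Fin (sk.l k.succ) → ℝ) :
    l2 (E *ᵥ v) ≤ ℓ * d * (ℓ * e) * l2 v := by
  refine (l2_mulVec_le he v).trans ?_
  simp only [Fintype.card_prod, Fintype.card_fin, Nat.cast_mul]
  have h1 := h.card_left k.castSucc
  have h2 := h.card_right k.succ
  have h3 := l2_nonneg v
  rw [mul_assoc (_ * _) _ (l2 v)]
  gcongr

theorem abs_siteMoment_le (k : Fin n) (i : Fin (sk.m k.castSucc) × Fin d) (j : Fin (sk.l k.succ)) :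
    |sk.siteMoment p k i j| ≤ M * M := by
  obtain ⟨β, a⟩ := i
  rw [siteMoment_eq_pairing]
  exact abs_pairing_le h.nonneg h.sum_eq_one (fun x => h.bounded.2.1 _ _ _)
    (fun x => (abs_siteIndicator_mul_le k a x _).trans (h.bounded.2.2 _ _ _)) h.nonneg_bound

/-- Completeness at the right bond replaces `v` by a vector `w` of norm at most `l2 (W v) / c`,
where W is the bond moment. The site moment does not notice, as a left sketch times a site indicator
is a left function at that bond. -/
theorem l2_siteMoment_le_bondMoment (k : Fin n) (hk : k.succ ≠ Fin.last n)
    (v : Fin (sk.l k.succ) → ℝ) :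
    c * l2 (sk.siteMoment p k *ᵥ v) ≤ opConst d ℓ M * l2 (sk.bondMoment p k.succ *ᵥ v) := by
  obtain ⟨x₀⟩ := h.nonempty
  have hTv : DependsOn (fun x => sk.T k.succ x ⬝ᵥ v) (rightSites k.succ) :=
    dependsOn_dotProduct (sk.T_dependsOn _) v
  obtain ⟨w, hw, hcw⟩ := exists_sketch_eq_pairing x₀ h.pos
    (h.preservesRank _ (Fin.succ_ne_zero k) hk) hTv
  rw [← bondMoment_mulVec] at hcw
  have hZ : sk.siteMoment p k *ᵥ v = sk.siteMoment p k *ᵥ w := by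
    rw [siteMoment_mulVec, siteMoment_mulVec]
    ext ⟨β, a⟩
    have := hw (fun x => sk.S k.castSucc x β * siteIndicator k a x)
      (dependsOn_mul_siteIndicator fun x y hxy => by simp only [sk.S_dependsOn _ hxy])
    simp only [pairing] at this ⊢
    refine Eq.trans (Finset.sum_congr rfl fun x _ => by ring)
      (this.trans (Finset.sum_congr rfl fun x _ => by ring))
  have hM : 0 ≤ M * M := mul_self_nonneg M
  have h1 : l2 (sk.siteMoment p k *ᵥ w) ≤ opConst d ℓ M * l2 w := by
    refine (h.l2_siteError_le k (e := M * M + 1) (by linarith)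
      (fun i j => (h.abs_siteMoment_le k i j).trans (by linarith)) w).trans (le_of_eq ?_)
    rw [opConst]
  rw [hZ]
  calc c * l2 (sk.siteMoment p k *ᵥ w) ≤ c * (opConst d ℓ M * l2 w) :=
        mul_le_mul_of_nonneg_left h1 h.pos.le
    _ = opConst d ℓ M * (c * l2 w) := by ring
    _ ≤ _ := mul_le_mul_of_nonneg_left hcw (h.opConst_pos k).le

/-- The gauge computed from a perturbed site tensor is bounded, and keeps the exact bond matrix
uniformly injective. -/
theorem gauge_bounds (k : Fin n) (hk : k.succ ≠ Fin.last n) {R : ℕ}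
    (hR : R = unfoldingRank p k.succ) {Z : Matrix (Fin (sk.m k.castSucc) × Fin d) (Fin (sk.l k.succ)) ℝ}
    {e : ℝ} (he0 : 0 ≤ e) (he1 : e ≤ 1) (he : ∀ i j, |Z i j - sk.siteMoment p k i j| ≤ e)
    (hes : ℓ * d * (ℓ * e) ≤ gapConst d ℓ M c / 2) {q : Matrix (Fin (sk.l k.succ)) (Fin R) ℝ}
    (hq : IsTruncatedGauge Z q) :
    (∀ γ α, |q γ α| ≤ 1 / gapConst d ℓ M c) ∧
      ∀ u, bondConst d ℓ M c * l2 u ≤ l2 (sk.bondMoment p k.succ *ᵥ (q *ᵥ u)) := by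
  set s := gapConst d ℓ M c with hs
  have hspos : 0 < s := h.gapConst_pos k
  have hKpos : 0 < opConst d ℓ M := h.opConst_pos k
  have hdiff : ∀ v, l2 (Z *ᵥ v - sk.siteMoment p k *ᵥ v) ≤ s / 2 * l2 v := fun v => by
    rw [← Matrix.sub_mulVec]
    exact (h.l2_siteError_le k he0 (fun i j => he i j) v).trans
      (mul_le_mul_of_nonneg_right hes (l2_nonneg _))
  have hZle : ∀ v, l2 (Z *ᵥ v) ≤ opConst d ℓ M * l2 v := fun v => by
    refine (h.l2_siteError_le k (e := M * M + 1) (by nlinarith [mul_self_nonneg M])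
      (fun i j => ?_) v).trans (le_of_eq ?_)
    · calc |Z i j| = |(Z i j - sk.siteMoment p k i j) + sk.siteMoment p k i j| := by ring_nf
        _ ≤ e + M * M := (abs_add_le _ _).trans (add_le_add (he i j) (h.abs_siteMoment_le k i j))
        _ ≤ _ := by linarith
    · rw [opConst]
  -- Courant-Fischer with the subspace on which the bond moment is bounded below. The exact site
  -- moment has lower bound `2 * s` there, and the perturbation costs at most `s / 2`.
  have hsv : s ≤ singVal Z (R - 1) := by
    obtain ⟨-, Y, hY, hWY⟩ := exists_subspace_of_le_singVal h.pos
      (h.preservesRank _ (Fin.succ_ne_zero k) hk)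
    subst hR
    refine le_singVal_of_subspace (unfoldingRank_pos h.ne_zero _) hY fun u => ?_
    have h1 := h.l2_bondMoment_le k (Y *ᵥ u)
    have h2 : c * l2 u ≤ siteConst d ℓ M c * l2 (sk.siteMoment p k *ᵥ (Y *ᵥ u)) := (hWY u).trans h1
    have h3 : 2 * s * l2 u ≤ l2 (sk.siteMoment p k *ᵥ (Y *ᵥ u)) := by
      have hpos := h.siteConst_pos k
      rw [hs, gapConst, show 2 * (c / (2 * siteConst d ℓ M c)) * l2 u =
        (c * l2 u) / siteConst d ℓ M c by field_simp]
      exact (div_le_iff₀' hpos).2 h2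
    have h4 := l2_le_add_sub (sk.siteMoment p k *ᵥ (Y *ᵥ u)) (Z *ᵥ (Y *ᵥ u))
    rw [l2_sub_rev] at h4
    have h5 := hdiff (Y *ᵥ u)
    rw [hY] at h5
    nlinarith [l2_nonneg u]
  obtain ⟨V, hV1, hV2, rfl⟩ := hq
  have hσ : ∀ i : Fin R, s ≤ singVal Z i := fun i =>
    hsv.trans (singVal_antitone Z (show (_ : ℕ) ≤ _ by omega))
  have hσ' : ∀ i : Fin R, singVal Z i ≤ opConst d ℓ M := fun i => by
    have h1 := hZle (V *ᵥ Pi.single i 1)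
    rw [l2_mulVec_of_orthonormal hV1, l2_single, mul_one] at h1
    refine le_trans (le_of_sq_le_sq ?_ (l2_nonneg _)) h1
    rw [l2_sq_mulVec_rightSingularVectors hV1 hV2, Finset.sum_eq_single i]
    · simp
    · intro j _ hj
      simp [hj]
    · simp
  constructor
  · intro γ α
    rw [Matrix.mul_diagonal, abs_mul]
    have h1 : |V γ α| ≤ 1 := by
      refine (l2_mulVec_single V γ α).trans ?_
      rw [l2_mulVec_of_orthonormal hV1, l2_single]
    have h2 : |(singVal Z α)⁻¹| ≤ 1 / s := by
      rw [abs_of_nonneg (inv_nonneg.2 (singVal_nonneg _ _)), one_div]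
      exact inv_anti₀ hspos (hσ α)
    calc |V γ α| * |(singVal Z α)⁻¹| ≤ 1 * (1 / s) :=
          mul_le_mul h1 h2 (abs_nonneg _) zero_le_one
      _ = _ := one_mul _
  · intro u
    set u' : Fin R → ℝ := fun i => (singVal Z i)⁻¹ * u i with hu'
    have hqu : (V * Matrix.diagonal fun i : Fin R => (singVal Z i)⁻¹) *ᵥ u = V *ᵥ u' := by
      rw [← Matrix.mulVec_mulVec]
      congr 1
      ext i
      rw [Matrix.mulVec_diagonal]
    -- The inverse singular values in the gauge cannot be too small, because the singular values of
    -- `Z` are bounded above.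
    have huu' : l2 u ≤ opConst d ℓ M * l2 u' := by
      refine le_of_sq_le_sq ?_ (mul_nonneg hKpos.le (l2_nonneg _))
      rw [mul_pow, l2_sq_eq_sum, l2_sq_eq_sum, Finset.mul_sum]
      refine Finset.sum_le_sum fun i _ => ?_
      have hi : u i = singVal Z i * u' i := by
        rw [hu']
        field_simp [(hspos.trans_le (hσ i)).ne']
      rw [hi, mul_pow]
      exact mul_le_mul_of_nonneg_right (pow_le_pow_left₀ (singVal_nonneg _ _) (hσ' i) 2)
        (sq_nonneg _)
    rw [hqu]
    have h1 := le_l2_mulVec_rightSingularVectors hV1 hV2 hspos.le hsv u'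
    have h2 := hdiff (V *ᵥ u')
    rw [l2_mulVec_of_orthonormal hV1] at h2
    have h3 := l2_le_add_sub (Z *ᵥ (V *ᵥ u')) (sk.siteMoment p k *ᵥ (V *ᵥ u'))
    have h4 : s / 2 * l2 u' ≤ l2 (sk.siteMoment p k *ᵥ (V *ᵥ u')) := by linarith
    have h5 := h.l2_siteMoment_le_bondMoment k hk (V *ᵥ u')
    rw [bondConst, ← hs, div_mul_eq_mul_div, div_le_iff₀ (mul_pos hKpos hKpos)]
    have hcpos := h.pos
    calc c * (s / 2) * l2 u ≤ c * (s / 2) * (opConst d ℓ M * l2 u') := by gcongr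
      _ = c * (s / 2 * l2 u') * opConst d ℓ M := by ring
      _ ≤ c * l2 (sk.siteMoment p k *ᵥ (V *ᵥ u')) * opConst d ℓ M := by gcongr
      _ ≤ opConst d ℓ M * l2 (sk.bondMoment p k.succ *ᵥ (V *ᵥ u')) * opConst d ℓ M := by gcongr
      _ = _ := by ring

end Sketch.IsAdapted

/-! ### Partial products of the cores -/

namespace MPS

variable {n d : ℕ} (θ : MPS n d)

/-- The product of the cores to the left of the bond `k`. -/
def leftProd (k : Fin (n + 1)) : Config n d → Fin (θ.bond k) → ℝ :=
  Fin.induction (motive := fun k => Config n d → Fin (θ.bond k) → ℝ) (fun _ _ => 1)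
    (fun k F x α' => ∑ α, F x α * θ.core k (x k) α α') k

theorem leftProd_zero (x : Config n d) (α : Fin (θ.bond 0)) : θ.leftProd 0 x α = 1 := rfl

theorem leftProd_succ (k : Fin n) (x : Config n d) (α' : Fin (θ.bond k.succ)) :
    θ.leftProd k.succ x α' = ∑ α, θ.leftProd k.castSucc x α * θ.core k (x k) α α' := by
  simp only [leftProd, Fin.induction_succ]

theorem leftProd_dependsOn (k : Fin (n + 1)) : DependsOn (θ.leftProd k) (leftSites k) := by
  induction k using Fin.induction with
  | zero => exact fun x y _ => rfl
  | succ k ih =>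
    intro x y h
    ext α'
    rw [leftProd_succ, leftProd_succ, h k (by simp),
      ih fun i hi => h i (lt_trans hi Fin.castSucc_lt_succ)]

end MPS

/-- Transfer matrix summation. The terminal weight `g` is arbitrary so that the induction can absorb
the last factor into it. -/
theorem sum_prod_path_eq {n : ℕ} (ι : Fin (n + 1) → Type) [∀ k, Fintype (ι k)]
    (w : (k : Fin n) → ι k.castSucc → ι k.succ → ℝ) (F : (k : Fin (n + 1)) → ι k → ℝ)
    (hF0 : ∀ a, F 0 a = 1) (hF : ∀ k b, F k.succ b = ∑ a, F k.castSucc a * w k a b)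
    (g : ι (Fin.last n) → ℝ) :
    ∑ α : (k : Fin (n + 1)) → ι k, (∏ k, w k (α k.castSucc) (α k.succ)) * g (α (Fin.last n)) =
      ∑ a, F (Fin.last n) a * g a := by
  induction n with
  | zero =>
    rw [← (Fin.snocEquiv ι).sum_comp, Fintype.sum_prod_type]
    refine Finset.sum_congr rfl fun a _ => ?_
    have : F (Fin.last 0) a = 1 := hF0 a
    rw [this]
    simp only [Finset.univ_eq_empty, Finset.prod_empty, one_mul, Fin.snocEquiv, Equiv.coe_fn_mk]
    rw [Finset.univ_unique, Finset.sum_singleton]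
    exact congrArg g (Fin.snoc_last (α := ι) _ _)
  | succ n ih =>
    rw [← (Fin.snocEquiv ι).sum_comp, Fintype.sum_prod_type]
    have h1 : ∀ b, F (Fin.last (n + 1)) b * g b = ∑ a, F (Fin.last n).castSucc a *
        (w (Fin.last n) a b * g b) := fun b => by
      have : F (Fin.last (n + 1)) b = ∑ a, F (Fin.last n).castSucc a * w (Fin.last n) a b :=
        hF (Fin.last n) b
      rw [this, Finset.sum_mul]
      exact Finset.sum_congr rfl fun a _ => by ring
    refine Finset.sum_congr rfl fun b _ => ?_
    rw [h1]
    refine Eq.trans ?_ (ih (fun k => ι k.castSucc) (fun k => w k.castSucc) (fun k => F k.castSucc)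
      hF0 (fun k b => hF k.castSucc b) (fun a => w (Fin.last n) a b * g b))
    refine Finset.sum_congr rfl fun α _ => ?_
    rw [Fin.prod_univ_castSucc]
    simp only [Fin.snocEquiv, Equiv.coe_fn_mk, Fin.snoc_castSucc, ← Fin.castSucc_succ,
      Fin.succ_last, Fin.snoc_last, mul_assoc]

namespace MPS

variable {n d : ℕ} (θ : MPS n d)

theorem eval_eq_sum_leftProd (x : Config n d) :
    θ.eval x = ∑ α, θ.leftProd (Fin.last n) x α := by
  have := sum_prod_path_eq (fun k => Fin (θ.bond k)) (fun k => θ.core k (x k))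
    (fun k => θ.leftProd k x) (fun a => rfl) (fun k b => θ.leftProd_succ k x b) (fun _ => 1)
  simpa [eval] using this

end MPS

/-! ### Exchanging cores one at a time: error propagation in ℓ¹ -/

section Hybrid

variable {n d : ℕ}

open Classical in
/-- The indicator function of agreement of two configurations on a set of sites. -/
def agree (s : Set (Fin n)) (x y : Config n d) : ℝ := if ∀ i ∈ s, x i = y i then 1 else 0

theorem agree_comm (s : Set (Fin n)) (x y : Config n d) : agree s x y = agree s y x := by
  have : (∀ i ∈ s, x i = y i) ↔ ∀ i ∈ s, y i = x i := forall₂_congr fun i _ => eq_comm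
  classical exact if_congr this rfl rfl

theorem agree_nonneg (s : Set (Fin n)) (x y : Config n d) : 0 ≤ agree s x y := by
  unfold agree; split_ifs <;> simp

theorem agree_mul_congr {s : Set (Fin n)} {f : Config n d → ℝ} (hf : DependsOn f s)
    (x y : Config n d) : agree s x y * f x = agree s x y * f y := by
  unfold agree
  split_ifs with h
  · rw [hf h]
  · simp

theorem agree_dependsOn (s : Set (Fin n)) (x : Config n d) : DependsOn (agree s · x) s :=
  fun y z h => by
    have : (∀ i ∈ s, y i = x i) ↔ ∀ i ∈ s, z i = x i :=
      forall₂_congr fun i hi => by rw [h i hi]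
    classical exact if_congr this rfl rfl

/-- Exactly one configuration glues the left half of `x` to the right half of `z`. -/
theorem sum_agree_mul_agree (k : Fin (n + 1)) (x z : Config n d) :
    ∑ y, agree (leftSites k) y x * agree (rightSites k) y z = 1 := by
  classical
  rw [Finset.sum_eq_single (fun i => if i.castSucc < k then x i else z i)]
  · have h1 : ∀ i ∈ leftSites k, (if i.castSucc < k then x i else z i) = x i :=
      fun i hi => if_pos hi
    have h2 : ∀ i ∈ rightSites k, (if i.castSucc < k then x i else z i) = z i :=
      fun i hi => if_neg hi
    rw [agree, agree, if_pos h1, if_pos h2, one_mul]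
  · intro y _ hy
    unfold agree
    split_ifs with h1 h2
    · refine absurd (funext fun i => ?_) hy
      split_ifs with hi
      exacts [h1 i hi, h2 i hi]
    all_goals simp
  · simp

theorem agree_rightSites_update (k : Fin n) (a : Fin d) (y z : Config n d) :
    agree (rightSites k.castSucc) y (Function.update z k a) =
      siteIndicator k a y * agree (rightSites k.succ) y z := by
  have : (∀ i ∈ rightSites k.castSucc, y i = Function.update z k a i) ↔
      y k = a ∧ ∀ i ∈ rightSites k.succ, y i = z i := by
    constructor
    · intro h
      refine ⟨by simpa using h k (by simp), fun i hi => ?_⟩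
      have hik : i ≠ k := fun hik => hi (hik ▸ Fin.castSucc_lt_succ)
      have := h i fun hi' => hi (lt_trans hi' Fin.castSucc_lt_succ)
      rwa [Function.update_of_ne hik] at this
    · rintro ⟨h1, h2⟩ i hi
      rcases eq_or_ne i k with rfl | hik
      · simpa using h1
      · rw [Function.update_of_ne hik]
        refine h2 i fun hi' => hi ?_
        rw [Fin.castSucc_lt_succ_iff] at hi'
        exact Fin.castSucc_lt_castSucc_iff.2 (lt_of_le_of_ne hi' hik)
  simp only [agree, siteIndicator, this]
  split_ifs <;> simp_all

/-- Here site k is prescribed by neither side, which leaves d choices. -/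
theorem sum_agree_mul_agree_succ (k : Fin n) (y z : Config n d) :
    ∑ x, agree (leftSites k.castSucc) x y * agree (rightSites k.succ) x z = d := by
  have h1 : ∀ x : Config n d, ∑ a, siteIndicator k a x = 1 := fun x => by simp [siteIndicator]
  calc ∑ x, agree (leftSites k.castSucc) x y * agree (rightSites k.succ) x z
      = ∑ x, ∑ a, agree (leftSites k.castSucc) x y *
          agree (rightSites k.castSucc) x (Function.update z k a) := by
        refine Finset.sum_congr rfl fun x _ => ?_
        simp only [agree_rightSites_update, ← Finset.mul_sum, ← Finset.sum_mul, h1, one_mul]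
    _ = d := by
        rw [Finset.sum_comm]
        simp [sum_agree_mul_agree]

variable (p : Config n d → ℝ) (ψ : MPS n d) (D E : (k : Fin (n + 1)) → Config n d → Fin (ψ.bond k) → ℝ)

/-- The exact core at the site `k` in the frames `D`, `E`. -/
def exactCore (k : Fin n) (a : Fin d) (α : Fin (ψ.bond k.castSucc)) (α' : Fin (ψ.bond k.succ)) : ℝ :=
  pairing p (E k.castSucc · α) (fun x => siteIndicator k a x * D k.succ x α')

/-- The product of the exact cores to the right of the bond `k`. -/
def exactRight (k : Fin (n + 1)) (α : Fin (ψ.bond k)) (x : Config n d) : ℝ :=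
  pairing p (E k · α) (agree (rightSites k) · x)

/-- The tensor with the cores of `ψ` to the left of the bond `k` and exact cores to the right of it. -/
def hybrid (k : Fin (n + 1)) (x : Config n d) : ℝ :=
  ∑ α, ψ.leftProd k x α * exactRight p ψ E k α x

variable {p ψ D E} {K : ℝ} (hF : ∀ k, IsBondFrame p k (D k) (E k) K)
include hF

/-- The frame factorization at the right bond of site k, applied to a left dual function times the
indicator of x_k, makes the exact cores multiply up to `p`. -/
theorem exactRight_castSucc (k : Fin n) (α : Fin (ψ.bond k.castSucc)) (x : Config n d) :
    exactRight p ψ E k.castSucc α x =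
      ∑ α', exactCore p ψ D E k (x k) α α' * exactRight p ψ E k.succ α' x := by
  have h := (hF k.succ).pairing_eq (fun y => E k.castSucc y α * siteIndicator k (x k) y)
    (agree (rightSites k.succ) · x) (dependsOn_mul_siteIndicator fun y z hyz => by
      simp only [(hF k.castSucc).left_dependsOn hyz]) (agree_dependsOn _ _)
  have h1 : exactRight p ψ E k.castSucc α x =
      pairing p (fun y => E k.castSucc y α * siteIndicator k (x k) y)
        (agree (rightSites k.succ) · x) := by
    refine Finset.sum_congr rfl fun y _ => ?_
    have := agree_rightSites_update k (x k) y x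
    rw [Function.update_eq_self] at this
    simp only [this]
    ring
  rw [h1, h]
  refine Finset.sum_congr rfl fun α' _ => ?_
  congr 1
  exact Finset.sum_congr rfl fun y _ => by ring

theorem hybrid_succ_sub (k : Fin n) (x : Config n d) :
    hybrid p ψ E k.succ x - hybrid p ψ E k.castSucc x = ∑ α, ∑ α', ψ.leftProd k.castSucc x α *
      (ψ.core k (x k) α α' - exactCore p ψ D E k (x k) α α') * exactRight p ψ E k.succ α' x := by
  have h1 : hybrid p ψ E k.succ x = ∑ α, ∑ α', ψ.leftProd k.castSucc x α *
      ψ.core k (x k) α α' * exactRight p ψ E k.succ α' x := by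
    rw [Finset.sum_comm]
    refine Finset.sum_congr rfl fun α' _ => ?_
    rw [ψ.leftProd_succ, Finset.sum_mul]
  have h2 : hybrid p ψ E k.castSucc x = ∑ α, ∑ α', ψ.leftProd k.castSucc x α *
      exactCore p ψ D E k (x k) α α' * exactRight p ψ E k.succ α' x := by
    refine Finset.sum_congr rfl fun α _ => ?_
    rw [exactRight_castSucc hF, Finset.mul_sum]
    exact Finset.sum_congr rfl fun α' _ => by ring
  rw [h1, h2, ← Finset.sum_sub_distrib]
  refine Finset.sum_congr rfl fun α _ => ?_
  rw [← Finset.sum_sub_distrib]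
  exact Finset.sum_congr rfl fun α' _ => by ring

/-- Pairing the exact right part with the dual function `D` isolates one index of the left product.
The left product is thus controlled by the ℓ¹ mass of the hybrid tensor instead of by a product of
core norms, which could grow exponentially in n. -/
theorem leftProd_eq_sum_hybrid (k : Fin (n + 1)) (x : Config n d) (α : Fin (ψ.bond k)) :
    ψ.leftProd k x α = ∑ y, agree (leftSites k) y x * (hybrid p ψ E k y * D k y α) := by
  have hD : DependsOn (D k · α) (rightSites k) := fun y z h => by
    simp only [(hF k).right_dependsOn h]
  have hL : ∀ α', DependsOn (ψ.leftProd k · α') (leftSites k) := fun α' y z h => by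
    simp only [ψ.leftProd_dependsOn k h]
  calc ψ.leftProd k x α
      = ∑ α', ψ.leftProd k x α' * pairing p (E k · α') (D k · α) := by
        simp [(hF k).dual]
    -- The inserted factor 1 sums over the configuration `y` glued from `x` and `z`; afterwards both
    -- the left product and `D` can be evaluated at `y`.
    _ = ∑ α', ψ.leftProd k x α' * ∑ z, E k z α' * p z * D k z α *
          ∑ y, agree (leftSites k) y x * agree (rightSites k) y z := by
        simp only [sum_agree_mul_agree, mul_one, pairing]
    _ = ∑ α', ∑ y, ψ.leftProd k y α' * (agree (leftSites k) y x *
          (exactRight p ψ E k α' y * D k y α)) := by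
        refine Finset.sum_congr rfl fun α' _ => ?_
        simp only [Finset.mul_sum]
        rw [Finset.sum_comm]
        refine Finset.sum_congr rfl fun y _ => ?_
        have h1 := agree_mul_congr (hL α') y x
        simp only [exactRight, pairing, Finset.sum_mul, Finset.mul_sum]
        refine Finset.sum_congr rfl fun z _ => ?_
        have h2 := agree_mul_congr hD y z
        rw [agree_comm _ z y]
        linear_combination (-E k z α' * p z * D k z α * agree (rightSites k) y z) * h1 -
          (agree (leftSites k) y x * ψ.leftProd k y α' * E k z α' * p z) * h2
    _ = _ := by
        rw [Finset.sum_comm]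
        refine Finset.sum_congr rfl fun y _ => ?_
        rw [hybrid, Finset.sum_mul, Finset.mul_sum]
        exact Finset.sum_congr rfl fun α' _ => by ring

theorem abs_leftProd_le (k : Fin (n + 1)) (x : Config n d) (α : Fin (ψ.bond k)) :
    |ψ.leftProd k x α| ≤ K * ∑ y, agree (leftSites k) y x * |hybrid p ψ E k y| := by
  rw [leftProd_eq_sum_hybrid hF, Finset.mul_sum]
  refine (Finset.abs_sum_le_sum_abs _ _).trans (Finset.sum_le_sum fun y _ => ?_)
  rw [abs_mul, abs_mul, abs_of_nonneg (agree_nonneg _ _ _)]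
  have := mul_le_mul_of_nonneg_left ((hF k).right_le y α)
    (mul_nonneg (agree_nonneg (leftSites k) y x) (abs_nonneg (hybrid p ψ E k y)))
  linarith

theorem abs_exactRight_le (hp : ∀ x, 0 ≤ p x) (k : Fin (n + 1)) (x : Config n d)
    (α : Fin (ψ.bond k)) :
    |exactRight p ψ E k α x| ≤ K * ∑ z, agree (rightSites k) z x * p z := by
  rw [exactRight, pairing, Finset.mul_sum]
  refine (Finset.abs_sum_le_sum_abs _ _).trans (Finset.sum_le_sum fun z _ => ?_)
  rw [abs_mul, abs_mul, abs_of_nonneg (agree_nonneg _ _ _), abs_of_nonneg (hp z)]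
  have := mul_le_mul_of_nonneg_right ((hF k).left_le z α)
    (mul_nonneg (hp z) (agree_nonneg (rightSites k) z x))
  linarith

/-- The pointwise error is at most a constant times the left marginal of the absolute hybrid times
the right marginal of `p`. Since site k occurs in neither marginal, the sum of their product is `d`
times the ℓ¹ norm of the hybrid, with no loss in n. -/
theorem sum_abs_hybrid_succ_sub_le (hp : ∀ x, 0 ≤ p x) (hp1 : ∑ x, p x = 1) (hK : 0 ≤ K)
    {ℓ : ℕ} (hℓ : ∀ k, ψ.bond k ≤ ℓ) {η : ℝ} (hη0 : 0 ≤ η) (k : Fin n)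
    (hη : ∀ a α α', |ψ.core k a α α' - exactCore p ψ D E k a α α'| ≤ η) :
    ∑ x, |hybrid p ψ E k.succ x - hybrid p ψ E k.castSucc x| ≤
      (d * (ℓ * ℓ) * (K * K) * η) * ∑ x, |hybrid p ψ E k.castSucc x| := by
  set a : Config n d → ℝ := fun x =>
    ∑ y, agree (leftSites k.castSucc) y x * |hybrid p ψ E k.castSucc y| with ha
  set b : Config n d → ℝ := fun x => ∑ z, agree (rightSites k.succ) z x * p z with hb
  have ha0 : ∀ x, 0 ≤ a x := fun x => Finset.sum_nonneg fun y _ =>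
    mul_nonneg (agree_nonneg _ _ _) (abs_nonneg _)
  have hb0 : ∀ x, 0 ≤ b x := fun x => Finset.sum_nonneg fun y _ =>
    mul_nonneg (agree_nonneg _ _ _) (hp _)
  have hx : ∀ x, |hybrid p ψ E k.succ x - hybrid p ψ E k.castSucc x| ≤
      (ℓ * ℓ) * (K * K) * η * (a x * b x) := fun x => by
    rw [hybrid_succ_sub hF]
    have hterm : ∀ α α', |ψ.leftProd k.castSucc x α *
        (ψ.core k (x k) α α' - exactCore p ψ D E k (x k) α α') * exactRight p ψ E k.succ α' x| ≤
        (K * a x) * η * (K * b x) := fun α α' => by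
      rw [abs_mul, abs_mul]
      have h1 := abs_leftProd_le hF k.castSucc x α
      have h2 := abs_exactRight_le hF hp k.succ x α'
      have h3 := ha0 x
      have h4 := hη (x k) α α'
      gcongr
    calc _ ≤ ∑ α : Fin (ψ.bond k.castSucc), ∑ α' : Fin (ψ.bond k.succ),
          (K * a x) * η * (K * b x) :=
          (Finset.abs_sum_le_sum_abs _ _).trans (Finset.sum_le_sum fun α _ =>
            (Finset.abs_sum_le_sum_abs _ _).trans (Finset.sum_le_sum fun α' _ => hterm α α'))
      _ = ((ψ.bond k.castSucc : ℝ) * ψ.bond k.succ) * ((K * a x) * η * (K * b x)) := by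
          simp [mul_assoc]
      _ ≤ (ℓ * ℓ) * ((K * a x) * η * (K * b x)) := by
          have h1 : (ψ.bond k.castSucc : ℝ) ≤ ℓ := by exact_mod_cast hℓ _
          have h2 : (ψ.bond k.succ : ℝ) ≤ ℓ := by exact_mod_cast hℓ _
          have h3 := ha0 x
          have h4 := hb0 x
          gcongr
      _ = _ := by ring
  have hab : ∑ x, a x * b x = d * ∑ x, |hybrid p ψ E k.castSucc x| := by
    calc ∑ x, a x * b x = ∑ x, ∑ y, ∑ z, (|hybrid p ψ E k.castSucc y| * p z) *
          (agree (leftSites k.castSucc) x y * agree (rightSites k.succ) x z) := by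
          refine Finset.sum_congr rfl fun x _ => ?_
          simp only [ha, hb]
          rw [Finset.sum_mul_sum]
          refine Finset.sum_congr rfl fun y _ => Finset.sum_congr rfl fun z _ => ?_
          rw [agree_comm _ y x, agree_comm _ z x]
          ring
      _ = ∑ y, ∑ z, (|hybrid p ψ E k.castSucc y| * p z) * d := by
          rw [Finset.sum_comm]
          refine Finset.sum_congr rfl fun y _ => ?_
          rw [Finset.sum_comm]
          refine Finset.sum_congr rfl fun z _ => ?_
          rw [← Finset.mul_sum, sum_agree_mul_agree_succ]
      _ = _ := by
          simp only [← Finset.sum_mul, ← Finset.mul_sum, hp1]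
          ring
  calc _ ≤ ∑ x, (ℓ * ℓ) * (K * K) * η * (a x * b x) := Finset.sum_le_sum fun x _ => hx x
    _ = _ := by rw [← Finset.mul_sum, hab]; ring

/-- If all cores are close to the exact ones, then the tensor is close to `p` in the `ℓ¹` norm. -/
theorem sum_abs_eval_sub_le (hp : ∀ x, 0 ≤ p x) (hp1 : ∑ x, p x = 1) (hK : 0 ≤ K)
    {ℓ : ℕ} (hℓ : ∀ k, ψ.bond k ≤ ℓ) {η : ℝ} (hη0 : 0 ≤ η)
    (hη : ∀ k a α α', |ψ.core k a α α' - exactCore p ψ D E k a α α'| ≤ η)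
    (hE0 : ∀ x α, E 0 x α = 1) (hEn : ∀ x α, E (Fin.last n) x α = 1)
    (hsmall : 2 * n * (d * (ℓ * ℓ) * (K * K) * η) ≤ 1) :
    ∑ x, |ψ.eval x - p x| ≤ 2 * n * (d * (ℓ * ℓ) * (K * K) * η) := by
  set τ : ℝ := d * (ℓ * ℓ) * (K * K) * η with hτ
  have hτ0 : 0 ≤ τ := by positivity
  have h0 : hybrid p ψ E 0 = p := by
    ext x
    have hx : ∀ α, exactRight p ψ E 0 α x = p x := fun α => by
      rw [exactRight, pairing, Finset.sum_eq_single x]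
      · simp [hE0, agree]
      · intro y _ hy
        have : ¬ ∀ i ∈ rightSites (0 : Fin (n + 1)), y i = x i := fun h =>
          hy (funext fun i => h i (Fin.not_lt_zero _))
        simp only [agree, if_neg this, mul_zero]
      · simp
    simp [hybrid, MPS.leftProd_zero, hx, ψ.bond_zero]
  have hn : hybrid p ψ E (Fin.last n) = ψ.eval := by
    ext x
    have hx : ∀ α, exactRight p ψ E (Fin.last n) α x = 1 := fun α => by
      have : ∀ y : Config n d, agree (rightSites (Fin.last n)) y x = 1 := fun y =>
        if_pos fun i hi => absurd (Fin.castSucc_lt_last i) hi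
      simp [exactRight, pairing, hEn, this, hp1]
    simp [hybrid, hx, MPS.eval_eq_sum_leftProd]
  -- The smallness assumption keeps the ℓ¹ norm of every hybrid below 2, so each exchange adds at
  -- most `2 * τ`.
  have key : ∀ k : Fin (n + 1), ∑ x, |hybrid p ψ E k x - p x| ≤ 2 * (k : ℕ) * τ := by
    intro k
    induction k using Fin.induction with
    | zero => simp [h0]
    | succ k ih =>
      have hstep := sum_abs_hybrid_succ_sub_le hF hp hp1 hK hℓ hη0 k (hη k)
      have hkn : ((k : ℕ) : ℝ) ≤ n := by exact_mod_cast k.2.le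
      have h2 : ∑ x, |hybrid p ψ E k.castSucc x| ≤ 2 := by
        calc ∑ x, |hybrid p ψ E k.castSucc x|
            ≤ ∑ x, (|hybrid p ψ E k.castSucc x - p x| + p x) := Finset.sum_le_sum fun x _ => by
              have := abs_add_le (hybrid p ψ E k.castSucc x - p x) (p x)
              rwa [sub_add_cancel, abs_of_nonneg (hp x)] at this
          _ ≤ 2 * (k : ℕ) * τ + 1 := by
              rw [Finset.sum_add_distrib, hp1]
              have := ih
              simp only [Fin.val_castSucc] at this
              linarith
          _ ≤ 2 := by
              have : 2 * ((k : ℕ) : ℝ) * τ ≤ 2 * n * τ := by gcongr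
              linarith
      calc ∑ x, |hybrid p ψ E k.succ x - p x|
          ≤ ∑ x, (|hybrid p ψ E k.succ x - hybrid p ψ E k.castSucc x| +
              |hybrid p ψ E k.castSucc x - p x|) :=
            Finset.sum_le_sum fun x _ => abs_sub_le _ _ _
        _ ≤ τ * 2 + 2 * (k : ℕ) * τ := by
            rw [Finset.sum_add_distrib]
            refine add_le_add (hstep.trans (mul_le_mul_of_nonneg_left h2 hτ0)) ?_
            simpa using ih
        _ = _ := by simp only [Fin.val_succ, Nat.cast_add, Nat.cast_one]; ring
  have := key (Fin.last n)
  rwa [hn, Fin.val_last] at this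

end Hybrid

/-! ### Stability of the linear systems, and exact cores in the computed gauge -/

theorem l2_leastSquares_sub_le {m R ℓ : ℕ} (hm : m ≤ ℓ) (hR : R ≤ ℓ)
    {A A' : Matrix (Fin m) (Fin R) ℝ} {B B' : Fin m → ℝ} {g g' : Fin R → ℝ} {τ a G : ℝ}
    (hA : ∀ u, τ * l2 u ≤ l2 (A *ᵥ u)) (hAA : ∀ i j, |A' i j - A i j| ≤ a)
    (hBB : ∀ i, |B' i - B i| ≤ a) (hg : ∀ j, |g j| ≤ G) (ha : 0 ≤ a) (hG : 0 ≤ G)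
    (hsmall : ℓ * (ℓ * a) ≤ τ / 2) (hex : A *ᵥ g = B) (hls : (A'ᵀ * A') *ᵥ g' = A'ᵀ *ᵥ B') :
    τ / 2 * l2 (g' - g) ≤ ℓ * (a + ℓ * (a * G)) := by
  have hm' : (m : ℝ) ≤ ℓ := by exact_mod_cast hm
  have hR' : (R : ℝ) ≤ ℓ := by exact_mod_cast hR
  have hlow : ∀ u, τ / 2 * l2 u ≤ l2 (A' *ᵥ u) := fun u => by
    have h1 := l2_le_add_sub (A *ᵥ u) (A' *ᵥ u)
    rw [← Matrix.sub_mulVec] at h1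
    have h2 := l2_mulVec_le (E := A - A') (e := a)
      (fun i j => by rw [Matrix.sub_apply, abs_sub_comm]; exact hAA i j) u
    simp only [Fintype.card_fin] at h2
    have h3 := l2_nonneg u
    have h4 : (m : ℝ) * (R * a * l2 u) ≤ ℓ * (ℓ * a * l2 u) := by gcongr
    have h5 := hA u
    nlinarith [mul_le_mul_of_nonneg_right hsmall h3]
  -- The error solves the perturbed normal equations with right side `B' - A' *ᵥ g`, which is small
  -- since `A *ᵥ g = B` holds exactly.
  have hnormal : (A'ᵀ * A') *ᵥ (g' - g) = A'ᵀ *ᵥ (B' - A' *ᵥ g) := by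
    rw [Matrix.mulVec_sub, hls, Matrix.mulVec_sub, Matrix.mulVec_mulVec]
  refine (l2_le_of_normal_equation hlow hnormal).trans ?_
  refine (l2_le_card_mul (b := a + ℓ * (a * G)) fun i => ?_).trans ?_
  · have h1 : (B' - A' *ᵥ g) i = (B' i - B i) - ((A' - A) *ᵥ g) i := by
      rw [Matrix.sub_mulVec, hex]
      simp
    rw [h1]
    refine (abs_sub _ _).trans (add_le_add (hBB i) ?_)
    refine (abs_dotProduct_le_of_le (e := a) (b := G) (fun j => hAA i j) hg).trans ?_
    rw [Fintype.card_fin]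
    gcongr
  · rw [Fintype.card_fin]
    gcongr

theorem l2_mulVec_ones {m R : ℕ} (hm : m = 1) (hR : R = 1) {A : Matrix (Fin m) (Fin R) ℝ}
    (hA : ∀ i j, A i j = 1) (u : Fin R → ℝ) : l2 (A *ᵥ u) = l2 u := by
  subst hm hR
  congr 1
  ext i
  simp [Matrix.mulVec, dotProduct, hA, Subsingleton.elim i 0]

section Frames

variable {n d : ℕ} {p : Config n d → ℝ}

theorem isBondFrame_zero_of_eq_one (hp1 : ∑ x, p x = 1) {R : ℕ} (hR : R = 1)
    {D : Config n d → Fin R → ℝ} (hD : ∀ x α, D x α = 1) :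
    IsBondFrame p 0 D (fun _ _ => 1) 1 := by
  subst hR
  have : D = fun _ _ => 1 := by ext x α; exact hD x α
  rw [this]
  exact isBondFrame_zero hp1

theorem isBondFrame_last_of_eq_one (hp1 : ∑ x, p x = 1) {R : ℕ} (hR : R = 1)
    {D : Config n d → Fin R → ℝ} (hD : ∀ x α, D x α = 1) :
    IsBondFrame p (Fin.last n) D (fun _ _ => 1) 1 := by
  subst hR
  have : D = fun _ _ => 1 := by ext x α; exact hD x α
  rw [this]
  exact isBondFrame_last hp1

end Frames

/-- The right sketch functions in the gauge `q`. -/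
def gaugedSketch {n d R : ℕ} (sk : Sketch n d) {k : Fin (n + 1)} (q : Matrix (Fin (sk.l k)) (Fin R) ℝ)
    (x : Config n d) : Fin R → ℝ :=
  qᵀ *ᵥ sk.T k x

section Gauged

variable {n d R : ℕ} (sk : Sketch n d) (p : Config n d → ℝ)

theorem gaugedSketch_apply {k : Fin (n + 1)} (q : Matrix (Fin (sk.l k)) (Fin R) ℝ)
    (α : Fin R) (x : Config n d) : gaugedSketch sk q x α = sk.T k x ⬝ᵥ fun γ => q γ α :=
  dotProduct_comm (fun γ => q γ α) (sk.T k x)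

theorem pairing_gaugedSketch {k : Fin (n + 1)} (q : Matrix (Fin (sk.l k)) (Fin R) ℝ)
    (β : Fin (sk.m k)) (α : Fin R) :
    pairing p (sk.S k · β) (gaugedSketch sk q · α) = (sk.bondMoment p k * q) β α := by
  have := congrFun (bondMoment_mulVec sk p k fun γ => q γ α) β
  simp only [gaugedSketch_apply]
  exact this.symm

theorem pairing_site_gaugedSketch {k : Fin n} (q : Matrix (Fin (sk.l k.succ)) (Fin R) ℝ)
    (β : Fin (sk.m k.castSucc)) (a : Fin d) (α : Fin R) :
    pairing p (sk.S k.castSucc · β) (fun x => siteIndicator k a x * gaugedSketch sk q x α) =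
      (sk.siteMoment p k * q) (β, a) α := by
  have := congrFun (siteMoment_mulVec sk p k fun γ => q γ α) (β, a)
  simp only [gaugedSketch_apply]
  exact this.symm

theorem gaugedSketch_dependsOn {k : Fin (n + 1)} (q : Matrix (Fin (sk.l k)) (Fin R) ℝ) :
    DependsOn (gaugedSketch sk q) (rightSites k) := fun x y h => by
  simp only [gaugedSketch, sk.T_dependsOn k h]

theorem gaugedSketch_last {q : Matrix (Fin (sk.l (Fin.last n))) (Fin R) ℝ}
    (hq : ∀ γ α, q γ α = 1) (x : Config n d) (α : Fin R) : gaugedSketch sk q x α = 1 := by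
  simp [gaugedSketch_apply, dotProduct, hq, sk.T_last, sk.l_last]

end Gauged

namespace Sketch.IsAdapted

variable {n d ℓ : ℕ} {sk : Sketch n d} {p : Config n d → ℝ} {M c : ℝ}
  (h : sk.IsAdapted p ℓ M c)
include h

/-- The dual family is the pseudoinverse of the exact gauged bond matrix applied to the left
sketches. The lower bound `τ` bounds the pseudoinverse by `1 / τ`, and completeness of the gauged
right sketches gives the factorization. -/
theorem exists_isBondFrame {k : Fin (n + 1)} {R : ℕ} (hR : R = unfoldingRank p k)
    {q : Matrix (Fin (sk.l k)) (Fin R) ℝ} {κ τ : ℝ} (hτ : 0 < τ) (hκ : 0 ≤ κ)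
    (hq : ∀ γ α, |q γ α| ≤ κ)
    (hW : ∀ u, τ * l2 u ≤ l2 (sk.bondMoment p k *ᵥ (q *ᵥ u))) :
    ∃ E, IsBondFrame p k (gaugedSketch sk q) E (ℓ * (κ * M) + ℓ * (1 / τ * M)) := by
  obtain ⟨x₀⟩ := h.nonempty
  have hM := h.nonneg_bound
  have hℓ : (0 : ℝ) ≤ ℓ := Nat.cast_nonneg _
  set A := sk.bondMoment p k * q with hA
  have hAu : ∀ u, τ * l2 u ≤ l2 (A *ᵥ u) := fun u => by
    rw [hA, ← Matrix.mulVec_mulVec]; exact hW u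
  have hzero : ∀ u, A *ᵥ u = 0 → u = 0 := fun u hu => by
    have := hAu u
    rw [hu, l2_zero] at this
    exact l2_eq_zero.1 (le_antisymm (nonpos_of_mul_nonpos_right this hτ) (l2_nonneg _))
  have hdet : IsUnit (Aᵀ * A).det := by
    rw [isUnit_iff_ne_zero]
    intro h0
    obtain ⟨v, hv, hv0⟩ := Matrix.exists_mulVec_eq_zero_iff.2 h0
    refine hv (hzero v (l2_eq_zero.1 (pow_eq_zero_iff two_ne_zero |>.1 ?_)))
    rw [l2_sq, mulVec_dotProduct_mulVec, hv0, dotProduct_zero]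
  set P := (Aᵀ * A)⁻¹ * Aᵀ with hP
  have hPA : P * A = 1 := by rw [hP, Matrix.mul_assoc, Matrix.nonsing_inv_mul _ hdet]
  -- A column of `P` solves the normal equations with a unit vector on the right.
  have hPle : ∀ α β, |P α β| ≤ 1 / τ := fun α β => by
    refine (l2_mulVec_single P α β).trans ((le_div_iff₀' hτ).2 ?_)
    refine (l2_le_of_normal_equation hAu (r := Pi.single β 1) ?_).trans_eq (l2_single β)
    rw [Matrix.mulVec_mulVec, hP, ← Matrix.mul_assoc, Matrix.mul_nonsing_inv _ hdet, Matrix.one_mul]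
  have hdual : ∀ α α', pairing p (fun x => (P *ᵥ sk.S k x) α) (gaugedSketch sk q · α') =
      if α = α' then 1 else 0 := fun α α' => by
    have h1 := dotProduct_pairing p (gaugedSketch sk q · α') (sk.S k) (P α)
    simp only [pairing_gaugedSketch] at h1
    refine Eq.trans h1 ?_
    rw [← Matrix.one_apply, ← hPA]
    rfl
  have hEdep : DependsOn (fun x => P *ᵥ sk.S k x) (leftSites k) := fun x y hxy => by
    simp only [sk.S_dependsOn k hxy]
  have hDdep := gaugedSketch_dependsOn sk q
  refine ⟨fun x => P *ᵥ sk.S k x, hDdep, hEdep, fun x α => ?_, fun x α => ?_,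
    fun f g hf hg => ?_, hdual⟩
  · rw [gaugedSketch_apply, dotProduct_comm]
    refine (abs_dotProduct_le_of_le (fun γ => hq γ α) (h.bounded.2.2 k x)).trans ?_
    rw [Fintype.card_fin]
    have := mul_le_mul_of_nonneg_right (h.card_right k) (mul_nonneg hκ hM)
    have h2 : 0 ≤ (ℓ : ℝ) * (1 / τ * M) := by positivity
    linarith
  · refine (abs_dotProduct_le_of_le (hPle α) (h.bounded.2.1 k x)).trans ?_
    rw [Fintype.card_fin]
    have := mul_le_mul_of_nonneg_right (h.card_left k) (show 0 ≤ 1 / τ * M by positivity)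
    have h2 : 0 ≤ (ℓ : ℝ) * (κ * M) := by positivity
    linarith
  · obtain ⟨u, hu⟩ := exists_dotProduct_eq_pairing x₀ hR.symm hDdep (fun u hu => hzero u (by
      ext β
      have := hu (sk.S k · β) fun x y hxy => by simp only [sk.S_dependsOn k hxy]
      rw [pairing_dotProduct] at this
      simp only [pairing_gaugedSketch] at this
      exact this)) hg
    have hcoef : ∀ α, pairing p (fun x => (P *ᵥ sk.S k x) α) g = u α := fun α => by
      rw [hu _ fun x y hxy => by simp only [sk.S_dependsOn k hxy], pairing_dotProduct]
      simp only [hdual, dotProduct]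
      simp
    rw [hu f hf, pairing_dotProduct, dotProduct]
    exact Finset.sum_congr rfl fun α _ => by rw [hcoef]

end Sketch.IsAdapted

/-- A bound for the entries of the gauges. -/
def gaugeConst (d ℓ : ℕ) (M c : ℝ) : ℝ := 1 / gapConst d ℓ M c + 1

/-- A bound for the frames of the exact tensor. -/
def frameConst (d ℓ : ℕ) (M c : ℝ) : ℝ :=
  ℓ * (gaugeConst d ℓ M c * M) + ℓ * (1 / bondConst d ℓ M c * M) + 1

/-- A lower bound for the exact system matrices. -/
def systemConst (d ℓ : ℕ) (M c : ℝ) : ℝ := min (bondConst d ℓ M c) 1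

/-- The stability constant of the cores. -/
def coreConst (d ℓ : ℕ) (M c : ℝ) : ℝ :=
  2 / systemConst d ℓ M c * (ℓ * (ℓ * gaugeConst d ℓ M c +
    ℓ * (ℓ * gaugeConst d ℓ M c * (frameConst d ℓ M c * frameConst d ℓ M c))))

/-- The sketched tensors of `p'` and `p` differ by at most `e` in every entry. -/
def Sketch.IsClose {n d : ℕ} (sk : Sketch n d) (p p' : Config n d → ℝ) (e : ℝ) : Prop :=
  (∀ k i j, |sk.bondMoment p' k i j - sk.bondMoment p k i j| ≤ e) ∧
    ∀ k i j, |sk.siteMoment p' k i j - sk.siteMoment p k i j| ≤ e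

namespace Sketch.IsAdapted

variable {n d ℓ : ℕ} {sk : Sketch n d} {p : Config n d → ℝ} {M c : ℝ}
  (h : sk.IsAdapted p ℓ M c)
include h

theorem gaugeConst_pos (k : Fin n) : 0 < gaugeConst d ℓ M c := by
  have := one_div_pos.2 (h.gapConst_pos k)
  unfold gaugeConst; linarith

theorem frameConst_pos (k : Fin n) : 0 < frameConst d ℓ M c := by
  have h1 := h.gaugeConst_pos k
  have h2 := h.bondConst_pos k
  have h3 := h.nonneg_bound
  unfold frameConst; positivity

theorem systemConst_pos (k : Fin n) : 0 < systemConst d ℓ M c :=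
  lt_min (h.bondConst_pos k) one_pos

theorem coreConst_pos (k : Fin n) : 0 < coreConst d ℓ M c := by
  have h1 := h.gaugeConst_pos k
  have h2 := h.systemConst_pos k
  have h3 := h.frameConst_pos k
  have h4 : (1 : ℝ) ≤ ℓ := by exact_mod_cast h.one_le_card
  unfold coreConst; positivity

theorem unfoldingRank_le_card (k : Fin (n + 1)) (hk0 : k ≠ 0) (hk1 : k ≠ Fin.last n) :
    unfoldingRank p k ≤ sk.l k :=
  (exists_subspace_of_le_singVal h.pos (h.preservesRank k hk0 hk1)).1

/-- The frames are built from the gauge of `p'` but are dual with respect to `p`. Both systems thus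
share one gauge and differ only through the moments, so no perturbation theory for singular vectors
is needed. -/
theorem cores_close {p' : Config n d → ℝ} {e : ℝ} (he0 : 0 ≤ e) (he1 : e ≤ 1)
    (hclose : sk.IsClose p p' e) (hgap : ℓ * d * (ℓ * e) ≤ gapConst d ℓ M c / 2)
    (hsys : ℓ * (ℓ * (ℓ * (e * gaugeConst d ℓ M c))) ≤ systemConst d ℓ M c / 2)
    {ψ : MPS n d} (hψ : IsTTNSSketchOutput sk p' (unfoldingRank p) ψ) (k₀ : Fin n) :
    (∀ k, ψ.bond k ≤ ℓ) ∧ ∃ D E : (k : Fin (n + 1)) → Config n d → Fin (ψ.bond k) → ℝ,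
      (∀ k, IsBondFrame p k (D k) (E k) (frameConst d ℓ M c)) ∧
      (∀ x α, E 0 x α = 1) ∧ (∀ x α, E (Fin.last n) x α = 1) ∧
      ∀ k a α α', |ψ.core k a α α' - exactCore p ψ D E k a α α'| ≤ coreConst d ℓ M c * e := by
  obtain ⟨hbond, q, A, hqg, hqn, hA0, hA, hls⟩ := hψ
  have hbℓ : ∀ k, ψ.bond k ≤ ℓ := fun k => by
    by_cases hk0 : k = 0
    · rw [hk0, ψ.bond_zero]; exact h.one_le_card
    by_cases hk1 : k = Fin.last n
    · rw [hk1, ψ.bond_last]; exact h.one_le_card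
    rw [hbond]
    exact (h.unfoldingRank_le_card k hk0 hk1).trans (h.bounded.1 k).2
  refine ⟨hbℓ, ?_⟩
  have hgpos := h.gaugeConst_pos k₀
  have hbpos := h.bondConst_pos k₀
  have hspos := h.systemConst_pos k₀
  have hfpos := h.frameConst_pos k₀
  have hM := h.nonneg_bound
  have hf1 : 1 ≤ frameConst d ℓ M c := by
    have : 0 ≤ ℓ * (gaugeConst d ℓ M c * M) + ℓ * (1 / bondConst d ℓ M c * M) := by positivity
    unfold frameConst; linarith
  have hgauge : ∀ k : Fin n, k.succ ≠ Fin.last n →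
      (∀ γ α, |q k.succ γ α| ≤ 1 / gapConst d ℓ M c) ∧
      ∀ u, bondConst d ℓ M c * l2 u ≤ l2 (sk.bondMoment p k.succ *ᵥ (q k.succ *ᵥ u)) :=
    fun k hk => h.gauge_bounds k hk (hbond k.succ) he0 he1 (hclose.2 k) hgap (hqg k hk)
  -- The summand 1 in `gaugeConst` covers the last bond, where the gauge is identically 1.
  have hqle : ∀ k : Fin n, ∀ γ α, |q k.succ γ α| ≤ gaugeConst d ℓ M c := fun k γ α => by
    by_cases hk : k.succ = Fin.last n
    · have : ∀ j, j = Fin.last n → ∀ γ α, q j γ α = 1 := by rintro j rfl; exact hqn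
      rw [this _ hk, abs_one, gaugeConst]
      have := one_div_pos.2 (h.gapConst_pos k)
      linarith
    · exact ((hgauge k hk).1 γ α).trans (by unfold gaugeConst; linarith)
  -- An output leaves the gauge at bond 0 unconstrained and fixes `A 0` to be 1 instead; `D 0 = 1`
  -- matches this.
  set D : (k : Fin (n + 1)) → Config n d → Fin (ψ.bond k) → ℝ := fun k =>
    if k = 0 then fun _ _ => 1 else gaugedSketch sk (q k) with hD
  have hD0 : ∀ x α, D 0 x α = 1 := by simp [hD]
  have hDs : ∀ k : Fin n, D k.succ = gaugedSketch sk (q k.succ) := fun k =>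
    if_neg (Fin.succ_ne_zero k)
  have hframe : ∀ k, ∃ E, IsBondFrame p k (D k) E (frameConst d ℓ M c) ∧
      ((k = 0 ∨ k = Fin.last n) → ∀ x α, E x α = 1) := by
    intro k
    by_cases hk0 : k = 0
    · subst hk0
      exact ⟨_, (isBondFrame_zero_of_eq_one h.sum_eq_one ψ.bond_zero hD0).mono hf1,
        fun _ _ _ => rfl⟩
    by_cases hk1 : k = Fin.last n
    · subst hk1
      refine ⟨_, (isBondFrame_last_of_eq_one h.sum_eq_one ψ.bond_last fun x α => ?_).mono hf1,
        fun _ _ _ => rfl⟩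
      simp only [hD, if_neg hk0]
      exact gaugedSketch_last sk hqn x α
    obtain ⟨j, rfl⟩ := Fin.exists_succ_eq.2 hk0
    obtain ⟨E, hE⟩ := h.exists_isBondFrame (hbond j.succ) hbpos hgpos.le (hqle j) (hgauge j hk1).2
    refine ⟨E, ?_, fun hor => (hor.elim hk0 hk1).elim⟩
    rw [hDs]
    exact hE.mono (by unfold frameConst; linarith)
  choose E hE hE1 using hframe
  refine ⟨D, E, hE, hE1 0 (Or.inl rfl), hE1 _ (Or.inr rfl), ?_⟩
  have hsystem : ∀ k : Fin (n + 1), k ≠ Fin.last n →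
      (∀ u, systemConst d ℓ M c * l2 u ≤
        l2 ((Matrix.of fun β α => pairing p (sk.S k · β) (D k · α)) *ᵥ u)) ∧
      ∀ β α, |A k β α - pairing p (sk.S k · β) (D k · α)| ≤ ℓ * (e * gaugeConst d ℓ M c) := by
    intro k hk1
    by_cases hk0 : k = 0
    · subst hk0
      have hone : ∀ β α, pairing p (sk.S 0 · β) (D 0 · α) = 1 := fun β α => by
        simp [pairing, hD0, sk.S_zero, h.sum_eq_one]
      refine ⟨fun u => ?_, fun β α => ?_⟩
      · refine le_of_le_of_eq ?_ (l2_mulVec_ones (A := Matrix.of fun β α =>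
          pairing p (sk.S 0 · β) (D 0 · α)) sk.m_zero ψ.bond_zero hone u).symm
        exact mul_le_of_le_one_left (l2_nonneg u) (min_le_right _ _)
      · rw [hone, hA0, sub_self, abs_zero]
        positivity
    · obtain ⟨j, rfl⟩ := Fin.exists_succ_eq.2 hk0
      simp only [hDs, pairing_gaugedSketch]
      refine ⟨fun u => ?_, fun β α => ?_⟩
      · refine le_trans (mul_le_mul_of_nonneg_right (min_le_left _ _) (l2_nonneg u))
          (((hgauge j hk1).2 u).trans (le_of_eq ?_))
        rw [Matrix.mulVec_mulVec]
        rfl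
      · rw [hA _ hk0, ← Matrix.sub_apply, ← Matrix.sub_mul]
        refine (abs_dotProduct_le_of_le (fun γ => hclose.1 j.succ β γ)
          (fun γ => hqle j γ α)).trans ?_
        rw [Fintype.card_fin]
        exact mul_le_mul_of_nonneg_right (h.card_right _) (mul_nonneg he0 hgpos.le)
  intro k a α α'
  have hkl : k.castSucc ≠ Fin.last n := (Fin.castSucc_lt_last k).ne
  obtain ⟨hlow, hAclose⟩ := hsystem k.castSucc hkl
  have hDdep : DependsOn (fun x => siteIndicator k a x * D k.succ x α') (rightSites k.castSucc) :=
    dependsOn_siteIndicator_mul fun x y hxy => by simp only [(hE k.succ).right_dependsOn hxy]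
  have key := l2_leastSquares_sub_le (h.bounded.1 k.castSucc).1 (hbℓ k.castSucc)
    (A' := A k.castSucc) (g := fun α => exactCore p ψ D E k a α α') (g' := fun α => ψ.core k a α α')
    (B := fun β => pairing p (sk.S k.castSucc · β) (fun x => siteIndicator k a x * D k.succ x α'))
    (B' := fun β => (sk.siteMoment p' k * q k.succ) (β, a) α')
    (G := frameConst d ℓ M c * frameConst d ℓ M c) hlow hAclose
    (fun β => by
      rw [hDs, pairing_site_gaugedSketch, ← Matrix.sub_apply, ← Matrix.sub_mul]
      refine (abs_dotProduct_le_of_le (fun γ => hclose.2 k (β, a) γ)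
        (fun γ => hqle k γ α')).trans ?_
      rw [Fintype.card_fin]
      exact mul_le_mul_of_nonneg_right (h.card_right _) (mul_nonneg he0 hgpos.le))
    (fun α => abs_pairing_le h.nonneg h.sum_eq_one (fun x => (hE _).left_le x α)
      (fun x => (abs_siteIndicator_mul_le k a x _).trans ((hE _).right_le x α')) hfpos.le)
    (by positivity) (by positivity) hsys
    (by
      ext β
      -- The exact system is consistent: it is the frame factorization at the left bond, tested on
      -- the left sketches.
      exact ((hE k.castSucc).pairing_eq (sk.S k.castSucc · β) _
        (fun x y hxy => by simp only [sk.S_dependsOn _ hxy]) hDdep).symm)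
    (funext fun i => congrFun (congrFun (hls k a) i) α')
  have h1 := abs_le_l2 ((fun α => ψ.core k a α α') - fun α => exactCore p ψ D E k a α α') α
  rw [Pi.sub_apply] at h1
  refine h1.trans ?_
  rw [coreConst, div_mul_eq_mul_div, div_mul_eq_mul_div, le_div_iff₀ hspos]
  linear_combination 2 * key

end Sketch.IsAdapted

/-- The accuracy of the sketched tensors, relative to `ε / n`, that the algorithm needs. -/
def tolConst (d ℓ : ℕ) (M c : ℝ) : ℝ :=
  1 / (1 + 2 * (ℓ * d * ℓ) / gapConst d ℓ M c +
    2 * (ℓ * (ℓ * (ℓ * gaugeConst d ℓ M c))) / systemConst d ℓ M c +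
    8 * (d * (ℓ * ℓ) * (frameConst d ℓ M c * frameConst d ℓ M c) * coreConst d ℓ M c))

namespace Sketch.IsAdapted

variable {n d ℓ : ℕ} {sk : Sketch n d} {p : Config n d → ℝ} {M c : ℝ}
  (h : sk.IsAdapted p ℓ M c)
include h

theorem tolConst_pos (k : Fin n) : 0 < tolConst d ℓ M c := by
  have h1 := h.gaugeConst_pos k
  have h2 := h.systemConst_pos k
  have h3 := h.frameConst_pos k
  have h4 := h.gapConst_pos k
  have h5 := h.coreConst_pos k
  unfold tolConst; positivity

theorem sum_abs_eval_sub_le_of_isClose (hn : 1 ≤ n) {ε : ℝ} (hε : 0 < ε) (hε1 : ε ≤ 1)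
    {p' : Config n d → ℝ} (hclose : sk.IsClose p p' (tolConst d ℓ M c * ε / n))
    {ψ : MPS n d} (hψ : IsTTNSSketchOutput sk p' (unfoldingRank p) ψ) :
    ∑ x, |ψ.eval x - p x| ≤ ε / 4 := by
  have k₀ : Fin n := ⟨0, hn⟩
  have h1 := h.gaugeConst_pos k₀
  have h2 := h.systemConst_pos k₀
  have h3 := h.frameConst_pos k₀
  have h4 := h.gapConst_pos k₀
  have h5 := h.coreConst_pos k₀
  have ht := h.tolConst_pos k₀
  have hn' : (1 : ℝ) ≤ n := by exact_mod_cast hn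
  have hn0 : (0 : ℝ) < n := by linarith
  set t := tolConst d ℓ M c with htdef
  set e := t * ε / n with he
  have he0 : 0 ≤ e := by positivity
  have het : e ≤ t := by
    rw [he, div_le_iff₀ hn0]
    calc t * ε ≤ t * 1 := by gcongr
      _ ≤ t * n := by gcongr
  set a₁ := 2 * ((ℓ : ℝ) * d * ℓ) / gapConst d ℓ M c with ha₁
  set a₂ := 2 * ((ℓ : ℝ) * (ℓ * (ℓ * gaugeConst d ℓ M c))) / systemConst d ℓ M c with ha₂
  set a₃ := 8 * (d * ((ℓ : ℝ) * ℓ) * (frameConst d ℓ M c * frameConst d ℓ M c) * coreConst d ℓ M c)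
    with ha₃
  have ha₁0 : 0 ≤ a₁ := by positivity
  have ha₂0 : 0 ≤ a₂ := by positivity
  have ha₃0 : 0 ≤ a₃ := by positivity
  -- Each summand of the denominator of `tolConst` serves one requirement: `e ≤ 1`, the singular
  -- value gap, the stability of the systems, and a final error of at most `ε / 4`.
  have hmul : t * (1 + a₁ + a₂ + a₃) = 1 := by
    rw [htdef, tolConst, ← ha₁, ← ha₂, ← ha₃, one_div, inv_mul_cancel₀ (by positivity)]
  have ht1 : t * 1 ≤ 1 := by nlinarith
  have hta₁ : t * a₁ ≤ 1 := by nlinarith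
  have hta₂ : t * a₂ ≤ 1 := by nlinarith
  have hta₃ : t * a₃ ≤ 1 := by nlinarith
  have hgap : ℓ * d * (ℓ * e) ≤ gapConst d ℓ M c / 2 := by
    have : e * a₁ ≤ 1 := (mul_le_mul_of_nonneg_right het ha₁0).trans hta₁
    rw [ha₁, mul_div_assoc', div_le_one h4] at this
    linarith
  have hsys : ℓ * (ℓ * (ℓ * (e * gaugeConst d ℓ M c))) ≤ systemConst d ℓ M c / 2 := by
    have : e * a₂ ≤ 1 := (mul_le_mul_of_nonneg_right het ha₂0).trans hta₂
    rw [ha₂, mul_div_assoc', div_le_one h2] at this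
    linarith
  obtain ⟨hbℓ, D, E, hF, hE0, hEn, hcore⟩ :=
    h.cores_close he0 (het.trans (by linarith)) hclose hgap hsys hψ k₀
  have hfinal : 2 * n * (d * ((ℓ : ℝ) * ℓ) * (frameConst d ℓ M c * frameConst d ℓ M c) *
      (coreConst d ℓ M c * e)) ≤ ε / 4 := by
    have hne : n * e = t * ε := by rw [he]; field_simp
    have h6 : 2 * n * (d * ((ℓ : ℝ) * ℓ) * (frameConst d ℓ M c * frameConst d ℓ M c) *
      (coreConst d ℓ M c * e)) = (t * a₃) * ε / 4 := by
      rw [ha₃]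
      linear_combination 2 * (d * ((ℓ : ℝ) * ℓ) * (frameConst d ℓ M c * frameConst d ℓ M c) *
        coreConst d ℓ M c) * hne
    rw [h6]
    have := mul_le_mul_of_nonneg_right hta₃ hε.le
    linarith
  exact (sum_abs_eval_sub_le hF h.nonneg h.sum_eq_one h3.le hbℓ (by positivity) hcore hE0 hEn
    (hfinal.trans (by linarith))).trans hfinal

end Sketch.IsAdapted

/-- The ℓ¹ bound also puts the weight within `ε / 4` of 1, hence above 3/4; normalizing then costs
at most `(ε / 2) / (3 / 4) < ε`. -/
theorem MPS.norm_sub_lt_of_sum_abs_sub_le {n d : ℕ} {p : Config n d → ℝ} (hp : ∀ x, 0 ≤ p x)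
    (hp1 : ∑ x, p x = 1) {ψ : MPS n d} {ε : ℝ} (hε : 0 < ε) (hε1 : ε ≤ 1)
    (h : ∑ x, |ψ.eval x - p x| ≤ ε / 4) :
    ψ.weight ≠ 0 ∧ ‖p - ψ.directDensity‖ < ε ∧ ‖p - ψ.eval‖ < ε := by
  have hx : ∀ x, |ψ.eval x - p x| ≤ ε / 4 := fun x =>
    (Finset.single_le_sum (f := fun x => |ψ.eval x - p x|) (fun y _ => abs_nonneg _)
      (Finset.mem_univ x)).trans h
  have hpx : ∀ x, p x ≤ 1 := fun x => hp1 ▸ Finset.single_le_sum (f := p) (fun y _ => hp y)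
    (Finset.mem_univ x)
  have hw : |ψ.weight - 1| ≤ ε / 4 := by
    rw [MPS.weight, ← hp1, ← Finset.sum_sub_distrib]
    exact (Finset.abs_sum_le_sum_abs _ _).trans h
  have hw' : 3 / 4 ≤ ψ.weight := by linarith [(abs_le.1 hw).1]
  have hwpos : 0 < ψ.weight := by linarith
  refine ⟨hwpos.ne', ?_, ?_⟩
  · refine (pi_norm_lt_iff hε).2 fun x => ?_
    rw [Pi.sub_apply, MPS.directDensity, Real.norm_eq_abs]
    have h1 : p x - ψ.eval x / ψ.weight =
        ((p x - ψ.eval x) + p x * (ψ.weight - 1)) / ψ.weight := by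
      field_simp
      ring
    rw [h1, abs_div, abs_of_pos hwpos, div_lt_iff₀ hwpos]
    have h2 : |p x * (ψ.weight - 1)| ≤ 1 * (ε / 4) := by
      rw [abs_mul, abs_of_nonneg (hp x)]
      exact mul_le_mul (hpx x) hw (abs_nonneg _) zero_le_one
    have h3 := abs_add_le (p x - ψ.eval x) (p x * (ψ.weight - 1))
    have h4 := hx x
    rw [abs_sub_comm] at h4
    nlinarith
  · refine (pi_norm_lt_iff hε).2 fun x => ?_
    rw [Pi.sub_apply, Real.norm_eq_abs, abs_sub_comm]
    linarith [hx x]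

/-! ### Existence of outputs -/

section Existence

/-- `Aᵀ * A` and `Aᵀ` have the same rank, hence the same range, so the normal equations are always
solvable. -/
theorem exists_isLeastSquares {m R s : ℕ} (A : Matrix (Fin m) (Fin R) ℝ)
    (B : Matrix (Fin m) (Fin s) ℝ) : ∃ X, IsLeastSquares A X B := by
  have hle : LinearMap.range (Aᵀ * A).mulVecLin ≤ LinearMap.range Aᵀ.mulVecLin := by
    rintro _ ⟨u, rfl⟩
    exact ⟨A *ᵥ u, by simp⟩
  have heq := Submodule.eq_of_le_of_finrank_eq hle
    ((Matrix.rank_transpose_mul_self A).trans (Matrix.rank_transpose A).symm)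
  have hcol : ∀ j, ∃ u, (Aᵀ * A) *ᵥ u = Aᵀ *ᵥ fun i => B i j := fun j => by
    have : (Aᵀ *ᵥ fun i => B i j) ∈ LinearMap.range (Aᵀ * A).mulVecLin := heq ▸ ⟨_, rfl⟩
    exact this
  choose u hu using hcol
  refine ⟨Matrix.of fun i j => u j i, ?_⟩
  ext i j
  exact congrFun (hu j) i

variable {n d : ℕ} {p : Config n d → ℝ}

theorem unfoldingRank_zero (hp : p ≠ 0) : unfoldingRank p 0 = 1 := by
  refine le_antisymm ?_ (unfoldingRank_pos hp 0)
  have : IsEmpty {i : Fin n // i.castSucc < 0} := ⟨fun i => Fin.not_lt_zero _ i.2⟩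
  exact (Matrix.rank_le_card_height _).trans (by simp)

theorem unfoldingRank_last (hp : p ≠ 0) : unfoldingRank p (Fin.last n) = 1 := by
  refine le_antisymm ?_ (unfoldingRank_pos hp _)
  have : IsEmpty {i : Fin n // ¬ i.castSucc < Fin.last n} := ⟨fun i => i.2 (Fin.castSucc_lt_last _)⟩
  exact (Matrix.rank_le_card_width _).trans (by simp)

/-- The rank condition provides enough room for R orthonormal right singular vectors; every other
choice is always possible. -/
theorem exists_isTTNSSketchOutput {sk : Sketch n d} {R : Fin (n + 1) → ℕ} (hR0 : R 0 = 1)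
    (hRn : R (Fin.last n) = 1) (hR : ∀ k, k ≠ 0 → k ≠ Fin.last n → R k ≤ sk.l k)
    (p' : Config n d → ℝ) : ∃ ψ : MPS n d, IsTTNSSketchOutput sk p' R ψ := by
  have hq : ∀ k : Fin (n + 1), ∃ q : Matrix (Fin (sk.l k)) (Fin (R k)) ℝ,
      (∀ j : Fin n, (hj : j.succ = k) → k ≠ Fin.last n →
        IsTruncatedGauge (sk.siteMoment p' j) (hj ▸ q)) ∧
      (k = Fin.last n → ∀ γ α, q γ α = 1) := by
    intro k
    by_cases hkn : k = Fin.last n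
    · exact ⟨fun _ _ => 1, fun _ _ h => absurd hkn h, fun _ _ _ => rfl⟩
    by_cases hk0 : k = 0
    · exact ⟨0, fun j hj => absurd (hj.trans hk0) (Fin.succ_ne_zero j), fun h => absurd h hkn⟩
    obtain ⟨j, rfl⟩ := Fin.exists_succ_eq.2 hk0
    obtain ⟨q, hq⟩ := exists_isTruncatedGauge (sk.siteMoment p' j) (hR _ hk0 hkn)
    refine ⟨q, fun i hi _ => ?_, fun h => absurd h hkn⟩
    obtain rfl := Fin.succ_injective n hi
    exact hq
  choose q hq1 hq2 using hq
  let A : (k : Fin (n + 1)) → Matrix (Fin (sk.m k)) (Fin (R k)) ℝ := fun k =>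
    if k = 0 then fun _ _ => 1 else sk.bondMoment p' k * q k
  choose X hX using fun (k : Fin n) (a : Fin d) => exists_isLeastSquares (A k.castSucc)
    (Matrix.of fun β α => (sk.siteMoment p' k * q k.succ) (β, a) α)
  exact ⟨⟨R, hR0, hRn, X⟩, fun _ => rfl, q, A, fun k hk => hq1 k.succ k rfl hk, hq2 _ rfl,
    fun β α => by simp [A], fun k hk => if_neg hk, hX⟩

end Existence

/-! ### Concentration of the empirical moments -/

section Sampling

variable {n d : ℕ}

theorem massFn_nonneg (p : PMF (Config n d)) (x : Config n d) : 0 ≤ massFn p x :=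
  ENNReal.toReal_nonneg

theorem sum_massFn (p : PMF (Config n d)) : ∑ x, massFn p x = 1 := by
  have h := p.tsum_coe
  rw [tsum_fintype] at h
  rw [show ∑ x, massFn p x = (∑ x, p x).toReal from
    (ENNReal.toReal_sum fun x _ => p.apply_ne_top x).symm, h, ENNReal.toReal_one]

theorem measurable_config {α : Type*} [MeasurableSpace α] (f : Config n d → α) : Measurable f :=
  measurable_of_finite f

theorem sum_empirical_mul {B : ℕ} (ω : Fin B → Config n d) (g : Config n d → ℝ) :
    ∑ x, empirical ω x * g x = (∑ b, g (ω b)) / B := by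
  have h : ∀ x, empirical ω x * g x = (∑ b, if ω b = x then g x else 0) / B := fun x => by
    rw [empirical, div_mul_eq_mul_div, ← Finset.sum_filter, Finset.sum_const, nsmul_eq_mul]
  simp only [h, ← Finset.sum_div]
  rw [Finset.sum_comm]
  simp

instance (p : PMF (Config n d)) (B : ℕ) : IsProbabilityMeasure (sampleLaw p B) := by
  unfold sampleLaw; infer_instance

theorem integral_eval_sampleLaw (p : PMF (Config n d)) {B : ℕ} (f : Config n d → ℝ) (b : Fin B) :
    ∫ ω, f (ω b) ∂sampleLaw p B = ∑ x, massFn p x * f x := by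
  have h := measurePreserving_eval (fun _ : Fin B => p.toMeasure) b
  have h1 : ∫ ω, f (ω b) ∂sampleLaw p B = ∫ x, f x ∂p.toMeasure := by
    rw [← h.map_eq, integral_map h.measurable.aemeasurable
      (measurable_config f).aestronglyMeasurable]
    rfl
  rw [h1, PMF.integral_eq_sum]
  rfl

-- Hoeffding's inequality: a variable with values in [-K, K], once centered, is subgaussian with
-- variance proxy K².
open ProbabilityTheory in
theorem measureReal_sum_sub_ge_le (p : PMF (Config n d)) (B : ℕ) {f : Config n d → ℝ} {K t : ℝ}
    (hK : 0 ≤ K) (hf : ∀ x, |f x| ≤ K) (ht : 0 ≤ t) :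
    (sampleLaw p B).real {ω | t ≤ ∑ b, (f (ω b) - ∑ x, massFn p x * f x)} ≤
      Real.exp (-t ^ 2 / (2 * (B * K ^ 2))) := by
  have hind : iIndepFun (fun (b : Fin B) (ω : Fin B → Config n d) =>
      f (ω b) - ∑ x, massFn p x * f x) (sampleLaw p B) :=
    iIndepFun_pi (X := fun _ x => f x - ∑ x, massFn p x * f x)
      fun b => (measurable_config _).aemeasurable
  have hsub : ∀ b ∈ (Finset.univ : Finset (Fin B)), HasSubgaussianMGF
      (fun ω : Fin B → Config n d => f (ω b) - ∑ x, massFn p x * f x)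
      ((‖K - (-K)‖₊ / 2) ^ 2) (sampleLaw p B) := fun b _ => by
    rw [← integral_eval_sampleLaw p f b]
    exact hasSubgaussianMGF_of_mem_Icc
      ((measurable_config f).comp (measurable_pi_apply b)).aemeasurable
      (Filter.Eventually.of_forall fun ω => abs_le.1 (hf (ω b)))
  have h := HasSubgaussianMGF.measure_sum_ge_le_of_iIndepFun hind hsub ht
  refine h.trans (le_of_eq ?_)
  congr 2
  have h2 : ‖K - (-K)‖ / 2 = K := by
    rw [Real.norm_eq_abs, abs_of_nonneg (by linarith)]
    ring
  push_cast
  rw [h2]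
  simp

theorem measureReal_abs_empirical_sub_gt_le (p : PMF (Config n d)) {B : ℕ} (hB : 0 < B)
    {f : Config n d → ℝ} {K e : ℝ} (hK : 0 < K) (hf : ∀ x, |f x| ≤ K) (he : 0 ≤ e) :
    (sampleLaw p B).real {ω | e < |∑ x, empirical ω x * f x - ∑ x, massFn p x * f x|} ≤
      2 * Real.exp (-(e ^ 2 * B / (2 * K ^ 2))) := by
  have hB' : (0 : ℝ) < B := by exact_mod_cast hB
  have h1 := measureReal_sum_sub_ge_le p B hK.le hf (mul_nonneg he hB'.le)
  have h2 := measureReal_sum_sub_ge_le p B (f := fun x => -f x) hK.le (by simpa using hf)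
    (mul_nonneg he hB'.le)
  have hexp : -(e * B) ^ 2 / (2 * (B * K ^ 2)) = -(e ^ 2 * B / (2 * K ^ 2)) := by
    field_simp
  rw [hexp] at h1 h2
  rw [two_mul]
  refine (measureReal_mono ?_).trans ((measureReal_union_le _ _).trans (add_le_add h1 h2))
  intro ω hω
  have hω' : e < |∑ x, empirical ω x * f x - ∑ x, massFn p x * f x| := hω
  set m := ∑ x, massFn p x * f x with hm
  have hs : ∑ b, (f (ω b) - m) = B * (∑ x, empirical ω x * f x - m) := by
    rw [sum_empirical_mul, Finset.sum_sub_distrib]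
    simp only [Finset.sum_const, Finset.card_univ, Fintype.card_fin, nsmul_eq_mul]
    field_simp
  have hs' : ∑ b, (-f (ω b) - ∑ x, massFn p x * -f x) = -∑ b, (f (ω b) - m) := by
    rw [← Finset.sum_neg_distrib]
    refine Finset.sum_congr rfl fun b _ => ?_
    simp only [mul_neg, Finset.sum_neg_distrib, ← hm]
    ring
  rcases lt_abs.1 hω' with h | h
  · left
    change e * B ≤ ∑ b, (f (ω b) - m)
    rw [hs]
    nlinarith
  · right
    change e * B ≤ ∑ b, (-f (ω b) - ∑ x, massFn p x * -f x)
    rw [hs', hs]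
    nlinarith

/-- Each moment entry is the mean of a function bounded by `M * M`. The prefactor counts the entries
of all bond and site moments in a union bound. -/
theorem measureReal_not_isClose_le (p : PMF (Config n d)) {B : ℕ} (hB : 0 < B) {sk : Sketch n d}
    {ℓ : ℕ} {M : ℝ} (hsk : sk.BoundedBy ℓ M) (hM : 0 < M) {e : ℝ} (he : 0 ≤ e) :
    (sampleLaw p B).real {ω | ¬ sk.IsClose (massFn p) (empirical ω) e} ≤
      ((n + 1) * (ℓ * ℓ) + n * (ℓ * d * ℓ)) *
        (2 * Real.exp (-(e ^ 2 * B / (2 * (M * M) ^ 2)))) := by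
  set P := 2 * Real.exp (-(e ^ 2 * B / (2 * (M * M) ^ 2))) with hP
  have hP0 : 0 ≤ P := by positivity
  have hMM : 0 < M * M := mul_pos hM hM
  have hprod : ∀ {a b : ℝ}, |a| ≤ M → |b| ≤ M → |a * b| ≤ M * M := fun ha hb => by
    rw [abs_mul]; exact mul_le_mul ha hb (abs_nonneg _) hM.le
  have hbond : ∀ k i j, (sampleLaw p B).real {ω | e < |sk.bondMoment (empirical ω) k i j -
      sk.bondMoment (massFn p) k i j|} ≤ P := fun k i j => by
    have hr : ∀ p' : Config n d → ℝ, sk.bondMoment p' k i j =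
        ∑ x, p' x * (sk.S k x i * sk.T k x j) := fun p' =>
      Finset.sum_congr rfl fun x _ => by ring
    simp only [hr]
    exact measureReal_abs_empirical_sub_gt_le p hB hMM
      (fun x => hprod (hsk.2.1 _ _ _) (hsk.2.2 _ _ _)) he
  have hsite : ∀ k i j, (sampleLaw p B).real {ω | e < |sk.siteMoment (empirical ω) k i j -
      sk.siteMoment (massFn p) k i j|} ≤ P := fun k i j => by
    have hr : ∀ p' : Config n d → ℝ, sk.siteMoment p' k i j =
        ∑ x, p' x * (sk.S k.castSucc x i.1 * (siteIndicator k i.2 x * sk.T k.succ x j)) :=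
      fun p' => by
        rw [show i = (i.1, i.2) from rfl, siteMoment_eq_pairing]
        exact Finset.sum_congr rfl fun x _ => by ring
    simp only [hr]
    exact measureReal_abs_empirical_sub_gt_le p hB hMM
      (fun x => hprod (hsk.2.1 _ _ _) ((abs_siteIndicator_mul_le _ _ _ _).trans (hsk.2.2 _ _ _))) he
  have hsubset : {ω : Fin B → Config n d | ¬ sk.IsClose (massFn p) (empirical ω) e} ⊆
      (⋃ k, ⋃ i, ⋃ j, {ω | e < |sk.bondMoment (empirical ω) k i j -
        sk.bondMoment (massFn p) k i j|}) ∪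
      ⋃ k, ⋃ i, ⋃ j, {ω | e < |sk.siteMoment (empirical ω) k i j -
        sk.siteMoment (massFn p) k i j|} := by
    intro ω hω
    by_contra hcon
    refine hω ⟨fun k i j => ?_, fun k i j => ?_⟩ <;> by_contra hlt <;> apply hcon
    · exact Or.inl (Set.mem_iUnion.2 ⟨k, Set.mem_iUnion.2 ⟨i, Set.mem_iUnion.2
        ⟨j, not_le.1 hlt⟩⟩⟩)
    · exact Or.inr (Set.mem_iUnion.2 ⟨k, Set.mem_iUnion.2 ⟨i, Set.mem_iUnion.2
        ⟨j, not_le.1 hlt⟩⟩⟩)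
  have hunion : ∀ {κ : Type} [Fintype κ] {s : κ → Set (Fin B → Config n d)} {a : ℝ},
      (∀ k, (sampleLaw p B).real (s k) ≤ a) →
      (sampleLaw p B).real (⋃ k, s k) ≤ Fintype.card κ * a := fun {κ} _ {s a} hs => by
    refine (measureReal_iUnion_fintype_le s).trans
      ((Finset.sum_le_sum fun k _ => hs k).trans (le_of_eq ?_))
    simp
  have hm : ∀ k, (sk.m k : ℝ) ≤ ℓ := fun k => by exact_mod_cast (hsk.1 k).1
  have hl : ∀ k, (sk.l k : ℝ) ≤ ℓ := fun k => by exact_mod_cast (hsk.1 k).2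
  refine (measureReal_mono hsubset).trans ((measureReal_union_le _ _).trans ?_)
  rw [add_mul]
  refine add_le_add ?_ ?_
  · refine (hunion (a := ℓ * (ℓ * P)) fun k => (hunion (a := ℓ * P) fun i =>
      (hunion (hbond k i)).trans ?_).trans ?_).trans (le_of_eq ?_)
    · rw [Fintype.card_fin]; exact mul_le_mul_of_nonneg_right (hl k) hP0
    · rw [Fintype.card_fin]; exact mul_le_mul_of_nonneg_right (hm k) (by positivity)
    · rw [Fintype.card_fin]; push_cast; ring
  · refine (hunion (a := ℓ * d * (ℓ * P)) fun k => (hunion (a := ℓ * P) fun i =>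
      (hunion (hsite k i)).trans ?_).trans ?_).trans (le_of_eq ?_)
    · rw [Fintype.card_fin]; exact mul_le_mul_of_nonneg_right (hl k.succ) hP0
    · rw [Fintype.card_prod, Fintype.card_fin, Fintype.card_fin, Nat.cast_mul]
      have := hm k.castSucc
      gcongr
    · rw [Fintype.card_fin]; ring

end Sampling

/-- With `y = 2 * n / δ ≥ 2`, one factor `y` pays for `2 * n / δ` and the remaining `y ^ s` pays for
`s ≤ 2 ^ s`. The number of entries per site thus enters the constant and not the logarithm. -/
theorem mul_exp_neg_mul_log_le (s : ℕ) {n : ℕ} (hn : 1 ≤ n) {δ : ℝ} (hδ : 0 < δ) (hδ1 : δ ≤ 1) :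
    (n * s : ℝ) * (2 * Real.exp (-((1 + s : ℕ) * Real.log (2 * n / δ)))) ≤ δ := by
  have hn' : (1 : ℝ) ≤ n := by exact_mod_cast hn
  set y := 2 * (n : ℝ) / δ with hy
  have hy2 : 2 ≤ y := by rw [hy, le_div_iff₀ hδ]; nlinarith
  have hy0 : 0 < y := by linarith
  have hexp : Real.exp (-((1 + s : ℕ) * Real.log y)) = (y ^ (1 + s))⁻¹ := by
    rw [Real.exp_neg, Real.exp_nat_mul, Real.exp_log hy0]
  rw [hexp, show (n * s : ℝ) * (2 * (y ^ (1 + s))⁻¹) = (2 * n * s) / y ^ (1 + s) by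
    field_simp, div_le_iff₀ (by positivity)]
  have h2n : 2 * (n : ℝ) = y * δ := by rw [hy]; field_simp
  have hs : (s : ℝ) ≤ y ^ s := by
    have h1 : (s : ℝ) ≤ 2 ^ s := by exact_mod_cast Nat.lt_two_pow_self.le
    exact h1.trans (pow_le_pow_left₀ (by norm_num) hy2 s)
  rw [h2n, pow_add, pow_one]
  have : 0 ≤ y * δ := by positivity
  nlinarith [mul_le_mul_of_nonneg_left hs this]

/-! ### Ranks of Born machines and rank-preserving sketches -/

namespace MPS

variable {n d : ℕ} (θ : MPS n d)

/-- The product of the cores to the right of the bond `k`. -/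
def rightProd (k : Fin (n + 1)) : Config n d → Fin (θ.bond k) → ℝ :=
  Fin.reverseInduction (motive := fun k => Config n d → Fin (θ.bond k) → ℝ) (fun _ _ => 1)
    (fun k H x α => ∑ α', θ.core k (x k) α α' * H x α') k

theorem rightProd_last (x : Config n d) (α : Fin (θ.bond (Fin.last n))) :
    θ.rightProd (Fin.last n) x α = 1 := by
  simp only [rightProd, Fin.reverseInduction_last]

theorem rightProd_castSucc (k : Fin n) (x : Config n d) (α : Fin (θ.bond k.castSucc)) :
    θ.rightProd k.castSucc x α = ∑ α', θ.core k (x k) α α' * θ.rightProd k.succ x α' := by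
  simp only [rightProd, Fin.reverseInduction_castSucc]

theorem rightProd_dependsOn (k : Fin (n + 1)) : DependsOn (θ.rightProd k) (rightSites k) := by
  induction k using Fin.reverseInduction with
  | last =>
    intro x y _
    ext α
    rw [rightProd_last, rightProd_last]
  | cast k ih =>
    intro x y h
    ext α
    rw [rightProd_castSucc, rightProd_castSucc, h k (by simp),
      ih fun i hi => h i fun hi' => hi (lt_trans hi' Fin.castSucc_lt_succ)]

theorem eval_eq_sum_leftProd_mul_rightProd (k : Fin (n + 1)) (x : Config n d) :
    θ.eval x = ∑ α, θ.leftProd k x α * θ.rightProd k x α := by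
  induction k using Fin.reverseInduction with
  | last => simp [rightProd_last, eval_eq_sum_leftProd]
  | cast k ih =>
    rw [ih]
    simp only [leftProd_succ, rightProd_castSucc, Finset.sum_mul, Finset.mul_sum]
    rw [Finset.sum_comm]
    exact Finset.sum_congr rfl fun α _ => Finset.sum_congr rfl fun α' _ => by ring

end MPS

section Ranks

variable {n d : ℕ}

theorem unfoldingRank_le_card_of_eq_sum {ι : Type} [Fintype ι] {p : Config n d → ℝ}
    {k : Fin (n + 1)} (x₀ : Config n d) {F G : ι → Config n d → ℝ}
    (hF : ∀ i, DependsOn (F i) (leftSites k)) (hG : ∀ i, DependsOn (G i) (rightSites k))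
    (h : ∀ x, p x = ∑ i, F i x * G i x) : unfoldingRank p k ≤ Fintype.card ι := by
  have hU : unfolding p k =
      (Matrix.of fun y i => F i ((splitAt k).symm (y, (splitAt k x₀).2))) *
      (Matrix.of fun i z => G i ((splitAt k).symm ((splitAt k x₀).1, z))) := by
    ext y z
    rw [Matrix.mul_apply]
    refine (h ((splitAt k).symm (y, z))).trans (Finset.sum_congr rfl fun i _ => ?_)
    congr 1
    · exact hF i fun j hj => by rw [splitAt_symm_left _ _ hj, splitAt_symm_left _ _ hj]
    · exact hG i fun j hj => by rw [splitAt_symm_right _ _ hj, splitAt_symm_right _ _ hj]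
  rw [unfoldingRank, hU]
  exact (Matrix.rank_mul_le_left _ _).trans (Matrix.rank_le_card_width _)

theorem massFn_ne_zero (p : PMF (Config n d)) : massFn p ≠ 0 := fun h => by
  have := sum_massFn p
  simp [h] at this

/-- Squaring the factorization of the MPS at the bond yields a sum over pairs of bond indices. -/
theorem IsBornMachine.unfoldingRank_le {p : PMF (Config n d)} {θ : MPS n d}
    (h : IsBornMachine p θ) (k : Fin (n + 1)) : unfoldingRank (massFn p) k ≤ θ.bond k ^ 2 := by
  obtain ⟨x₀, -⟩ := p.support_nonempty
  set N : ℝ := ∑ z, |θ.eval z| ^ 2 with hN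
  have hle := unfoldingRank_le_card_of_eq_sum (p := massFn p) (k := k) x₀
    (F := fun (i : Fin (θ.bond k) × Fin (θ.bond k)) x =>
      θ.leftProd k x i.1 * θ.leftProd k x i.2 / N)
    (G := fun i x => θ.rightProd k x i.1 * θ.rightProd k x i.2)
    (fun i x y hxy => by simp only [θ.leftProd_dependsOn k hxy])
    (fun i x y hxy => by simp only [θ.rightProd_dependsOn k hxy])
    (fun x => by
      rw [h x, MPS.bornDensity, sq_abs, ← hN, sq, θ.eval_eq_sum_leftProd_mul_rightProd k,
        Finset.sum_mul_sum, Fintype.sum_prod_type, Finset.sum_div]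
      refine Finset.sum_congr rfl fun α _ => ?_
      rw [Finset.sum_div]
      exact Finset.sum_congr rfl fun α' _ => by ring)
  rwa [Fintype.card_prod, Fintype.card_fin, ← sq] at hle

/-- Choose rows that form a basis of the row space. -/
theorem Matrix.exists_rows_rank_eq {ι κ : Type*} [Fintype ι] [Fintype κ] {R : ℕ}
    (A : Matrix ι κ ℝ) (hR : A.rank = R) : ∃ r : Fin R → ι, (A.submatrix r id).rank = R := by
  obtain ⟨σ, a, ha, hspan, hli⟩ := exists_linearIndependent' ℝ A.row
  have : Fintype σ := Fintype.ofInjective a ha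
  have hcard : Fintype.card σ = R := by
    rw [← hR, Matrix.rank_eq_finrank_span_row, ← hspan, finrank_span_eq_card hli]
  let e : Fin R ≃ σ := (finCongr hcard.symm).trans (Fintype.equivFin σ).symm
  refine ⟨a ∘ e, ?_⟩
  have h : LinearIndependent ℝ (A.submatrix (a ∘ e) id).row := hli.comp e e.injective
  rw [h.rank_matrix, Fintype.card_fin]

theorem Matrix.exists_submatrix_rank_eq {ι κ : Type*} [Fintype ι] [Fintype κ] {R : ℕ}
    (A : Matrix ι κ ℝ) (hR : A.rank = R) :
    ∃ (r : Fin R → ι) (s : Fin R → κ), (A.submatrix r s).rank = R := by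
  obtain ⟨r, hr⟩ := Matrix.exists_rows_rank_eq A hR
  obtain ⟨s, hs⟩ := Matrix.exists_rows_rank_eq (A.submatrix r id)ᵀ
    ((Matrix.rank_transpose _).trans hr)
  exact ⟨r, s, (Matrix.rank_transpose _).symm.trans hs⟩

/-- Sketches by indicator functions of configurations of the left and of the right sites. -/
def indicatorSketch {p : Config n d → ℝ} (hp : p ≠ 0)
    (r : (k : Fin (n + 1)) → Fin (unfoldingRank p k) → {i : Fin n // i.castSucc < k} → Fin d)
    (s : (k : Fin (n + 1)) → Fin (unfoldingRank p k) → {i : Fin n // ¬ i.castSucc < k} → Fin d) :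
    Sketch n d where
  m := unfoldingRank p
  l := unfoldingRank p
  S k x β := if (splitAt k x).1 = r k β then 1 else 0
  T k x γ := if (splitAt k x).2 = s k γ then 1 else 0
  S_dependsOn k x y h := by
    have : (splitAt k x).1 = (splitAt k y).1 := funext fun i => h i i.2
    simp only [this]
  T_dependsOn k x y h := by
    have : (splitAt k x).2 = (splitAt k y).2 := funext fun i => h i i.2
    simp only [this]
  m_zero := unfoldingRank_zero hp
  l_last := unfoldingRank_last hp
  S_zero x β := if_pos (funext fun i => absurd i.2 (Fin.not_lt_zero _))
  T_last x γ := if_pos (funext fun i => absurd (Fin.castSucc_lt_last _) i.2)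

theorem bondMoment_indicatorSketch {p : Config n d → ℝ} (hp : p ≠ 0)
    (r : (k : Fin (n + 1)) → Fin (unfoldingRank p k) → {i : Fin n // i.castSucc < k} → Fin d)
    (s : (k : Fin (n + 1)) → Fin (unfoldingRank p k) → {i : Fin n // ¬ i.castSucc < k} → Fin d)
    (k : Fin (n + 1)) :
    (indicatorSketch hp r s).bondMoment p k = (unfolding p k).submatrix (r k) (s k) := by
  ext β γ
  refine (Fintype.sum_eq_single ((splitAt k).symm (r k β, s k γ)) fun x hx => ?_).trans ?_
  · by_cases h1 : (splitAt k x).1 = r k β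
    · have h2 : (splitAt k x).2 ≠ s k γ := fun h2 => hx (by
        rw [← h1, ← h2, Prod.mk.eta, Equiv.symm_apply_apply])
      exact mul_eq_zero_of_right _ (if_neg h2)
    · exact mul_eq_zero_of_left (mul_eq_zero_of_left (if_neg h1) _) _
  · simp only [indicatorSketch, Equiv.apply_symm_apply, if_true, one_mul, mul_one]
    rfl

/-- The sketched unfolding is a nonsingular R × R submatrix, so its R-th singular value is positive;
`c` is the minimum over the finitely many bonds. -/
theorem exists_sketch_preservesRank {p : Config n d → ℝ} (hp : p ≠ 0) :
    ∃ (sk : Sketch n d) (c : ℝ), 0 < c ∧ (∀ k, sk.m k = unfoldingRank p k) ∧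
      (∀ k, sk.l k = unfoldingRank p k) ∧ (∀ k x β, |sk.S k x β| ≤ 1) ∧
      (∀ k x γ, |sk.T k x γ| ≤ 1) ∧ sk.PreservesRank p c := by
  choose r s hrs using fun k => Matrix.exists_submatrix_rank_eq (unfolding p k)
    (rfl : _ = unfoldingRank p k)
  have hpos : ∀ k, 0 < singVal ((indicatorSketch hp r s).bondMoment p k) (unfoldingRank p k - 1) :=
    fun k => by
      have h1 := unfoldingRank_pos hp k
      refine singVal_pos_of_lt_rank _ ?_
      rw [bondMoment_indicatorSketch]
      exact (Nat.sub_lt h1 one_pos).trans_eq (hrs k).symm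
  refine ⟨indicatorSketch hp r s, Finset.univ.inf' Finset.univ_nonempty fun k =>
    singVal ((indicatorSketch hp r s).bondMoment p k) (unfoldingRank p k - 1),
    (Finset.lt_inf'_iff _).2 fun k _ => hpos k, fun _ => rfl, fun _ => rfl, fun k x β => ?_,
    fun k x γ => ?_, fun k _ _ => Finset.inf'_le _ (Finset.mem_univ k)⟩
  · simp only [indicatorSketch]; split_ifs <;> simp
  · simp only [indicatorSketch]; split_ifs <;> simp

end Ranks

/-- The constant of the sample complexity bound. -/
def sampleConst (d ℓ : ℕ) (M c : ℝ) : ℝ :=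
  max 1 (2 * (M * M) ^ 2 * (1 + ℓ * ℓ * (2 + d) : ℕ) / tolConst d ℓ M c ^ 2)

namespace Sketch.IsAdapted

variable {n d ℓ : ℕ} {sk : Sketch n d} {p : PMF (Config n d)} {M c : ℝ}
  (h : sk.IsAdapted (massFn p) ℓ M c)
include h

theorem measureReal_isClose_ge (hn : 1 ≤ n) {ε δ : ℝ} (hε : 0 < ε) (hδ : 0 < δ)
    (hδ1 : δ < 1) {B : ℕ}
    (hB : sampleConst d ℓ M c * (((n : ℝ) ^ 2 + ε * n) / ε ^ 2) * Real.log (2 * n / δ) ≤ B) :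
    1 - δ ≤ (sampleLaw p B).real
      {ω | sk.IsClose (massFn p) (empirical ω) (tolConst d ℓ M c * ε / n)} := by
  have k₀ : Fin n := ⟨0, hn⟩
  have ht := h.tolConst_pos k₀
  have hM : 0 < M := zero_lt_one.trans_le h.one_le
  have hn' : (1 : ℝ) ≤ n := by exact_mod_cast hn
  have hn0 : (0 : ℝ) < n := by linarith
  have hlog : 0 < Real.log (2 * n / δ) := Real.log_pos (by rw [lt_div_iff₀ hδ]; linarith)
  have hC : 1 ≤ sampleConst d ℓ M c := le_max_left _ _
  have hB0 : 0 < B := by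
    have : 0 < sampleConst d ℓ M c * (((n : ℝ) ^ 2 + ε * n) / ε ^ 2) * Real.log (2 * n / δ) := by
      positivity
    exact_mod_cast this.trans_le hB
  set e := tolConst d ℓ M c * ε / n with he
  set r : ℕ := 1 + ℓ * ℓ * (2 + d) with hr
  have hexp : (r : ℝ) * Real.log (2 * n / δ) ≤ e ^ 2 * B / (2 * (M * M) ^ 2) := by
    rw [le_div_iff₀ (by positivity)]
    have h1 : 2 * (M * M) ^ 2 * r ≤ sampleConst d ℓ M c * tolConst d ℓ M c ^ 2 :=
      (div_le_iff₀ (by positivity)).1 (le_max_right _ _)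
    calc (r : ℝ) * Real.log (2 * n / δ) * (2 * (M * M) ^ 2)
        = (2 * (M * M) ^ 2 * r) * Real.log (2 * n / δ) := by ring
      _ ≤ (sampleConst d ℓ M c * tolConst d ℓ M c ^ 2) * Real.log (2 * n / δ) :=
          mul_le_mul_of_nonneg_right h1 hlog.le
      _ = e ^ 2 * (sampleConst d ℓ M c * ((n : ℝ) ^ 2 / ε ^ 2) * Real.log (2 * n / δ)) := by
          rw [he]; field_simp
      -- The term `n ^ 2 / ε ^ 2` alone meets the requirement; `ε * n` only enlarges the sample.
      _ ≤ e ^ 2 * (sampleConst d ℓ M c * (((n : ℝ) ^ 2 + ε * n) / ε ^ 2) *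
            Real.log (2 * n / δ)) := by
          have h2 : (n : ℝ) ^ 2 ≤ (n : ℝ) ^ 2 + ε * n := by
            linarith [mul_pos hε hn0]
          gcongr
      _ ≤ e ^ 2 * B := mul_le_mul_of_nonneg_left hB (sq_nonneg _)
  have hbad : (sampleLaw p B).real {ω | ¬ sk.IsClose (massFn p) (empirical ω) e} ≤ δ := by
    refine (measureReal_not_isClose_le p hB0 h.bounded hM (by positivity)).trans ?_
    refine le_trans ?_ (mul_exp_neg_mul_log_le (ℓ * ℓ * (2 + d)) hn hδ hδ1.le)
    -- Uses `n + 1 ≤ 2 * n`.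
    have h1 : ((n : ℝ) + 1) * (ℓ * ℓ) + n * (ℓ * d * ℓ) ≤ n * (ℓ * ℓ * (2 + d) : ℕ) := by
      push_cast
      have : (0 : ℝ) ≤ ℓ * ℓ := by positivity
      nlinarith
    have h2 := Real.exp_le_exp.2 (neg_le_neg hexp)
    gcongr
  have hmeas : MeasurableSet {ω | sk.IsClose (massFn p) (empirical (B := B) ω) e} :=
    (Set.toFinite _).measurableSet
  have hcompl := probReal_compl_eq_one_sub (μ := sampleLaw p B) hmeas
  have : (sampleLaw p B).real {ω | sk.IsClose (massFn p) (empirical (B := B) ω) e}ᶜ ≤ δ := hbad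
  linarith

end Sketch.IsAdapted

end

theorem proposition2 :
    -- every Born machine admits rank-preserving sketches of size at most the squared bond dimension
    (∀ (n d : ℕ), 1 ≤ n → ∀ (p : PMF (Config n d)) (θ : MPS n d), IsBornMachine p θ →
      (∀ k, unfoldingRank (massFn p) k ≤ θ.bond k ^ 2) ∧
      ∃ (sk : Sketch n d) (c : ℝ), 0 < c ∧
        (∀ k, sk.m k ≤ θ.bond k ^ 2 ∧ sk.l k ≤ θ.bond k ^ 2) ∧
        (∀ k x β, |sk.S k x β| ≤ 1) ∧ (∀ k x γ, |sk.T k x γ| ≤ 1) ∧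
        sk.PreservesRank (massFn p) c) ∧
    -- the sample complexity, with a constant that depends only on `d`, `ℓ`, `M` and `c`
    (∀ (d ℓ : ℕ) (M c : ℝ), 0 < c → ∃ C : ℝ, 0 < C ∧
      ∀ (n : ℕ), 1 ≤ n → ∀ (p : PMF (Config n d)) (θ : MPS n d), IsBornMachine p θ →
      ∀ (sk : Sketch n d), sk.BoundedBy ℓ M → sk.PreservesRank (massFn p) c →
      ∀ (ε δ : ℝ), 0 < ε → ε ≤ 1 → 0 < δ → δ < 1 →
      ∀ (B : ℕ), C * (((n : ℝ) ^ 2 + ε * n) / ε ^ 2) * Real.log (2 * n / δ) ≤ B →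
        (∀ ω : Fin B → Config n d, ∃ ψ : MPS n d,
          IsTTNSSketchOutput sk (empirical ω) (unfoldingRank (massFn p)) ψ) ∧
        1 - δ ≤ (sampleLaw p B).real
          {ω | ∀ ψ : MPS n d,
            IsTTNSSketchOutput sk (empirical ω) (unfoldingRank (massFn p)) ψ →
              (∀ k, ψ.bond k ≤ θ.bond k ^ 2) ∧ ψ.weight ≠ 0 ∧
              ‖massFn p - ψ.directDensity‖ < ε ∧ ‖massFn p - ψ.eval‖ < ε}) := by
  refine ⟨fun n d _ p θ hθ => ⟨hθ.unfoldingRank_le, ?_⟩, fun d ℓ M c hc =>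
    ⟨sampleConst d ℓ (max M 1) c, zero_lt_one.trans_le (le_max_left _ _), ?_⟩⟩
  · obtain ⟨sk, c, hc, hm, hl, hS, hT, hsk⟩ := exists_sketch_preservesRank (massFn_ne_zero p)
    exact ⟨sk, c, hc, fun k => ⟨(hm k).trans_le (hθ.unfoldingRank_le k),
      (hl k).trans_le (hθ.unfoldingRank_le k)⟩, hS, hT, hsk⟩
  · intro n hn p θ hθ sk hbdd hpres ε δ hε hε1 hδ hδ1 B hB
    -- Enlarging the bound to `max M 1` secures the normalization `1 ≤ M` without further dependence
    -- of the constant.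
    have h : sk.IsAdapted (massFn p) ℓ (max M 1) c :=
      ⟨massFn_nonneg p, sum_massFn p,
        ⟨hbdd.1, fun k x β => (hbdd.2.1 k x β).trans (le_max_left _ _),
          fun k x γ => (hbdd.2.2 k x γ).trans (le_max_left _ _)⟩, le_max_right _ _, hc, hpres⟩
    refine ⟨fun ω => exists_isTTNSSketchOutput (unfoldingRank_zero h.ne_zero)
      (unfoldingRank_last h.ne_zero) h.unfoldingRank_le_card _,
      -- On the event that the moments are close, the error bound is deterministic, so it holds for
      -- all outputs simultaneously.
      (h.measureReal_isClose_ge hn hε hδ hδ1 hB).trans (measureReal_mono fun ω hω ψ hψ => ?_)⟩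
    exact ⟨fun k => (hψ.1 k).trans_le (hθ.unfoldingRank_le k),
      MPS.norm_sub_lt_of_sum_abs_sub_le h.nonneg h.sum_eq_one hε hε1
        (h.sum_abs_eval_sub_le_of_isClose hn hε hε1 hω hψ)⟩
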